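/- For $h>0$ let $\phi_h(z)=\frac{1}{\sqrt{2\pi}\,h}e^{-z^2/(2h^2)}$. For each $n$ let $G_\mu=G_{\mu,n}$ and $G_\sigma=G_{\sigma,n}$ be probability measures on $\mathbb R$ (they may, but need not, depend on $n$), and let $(X_i,\mu_i,\sigma_i)$, $1\le i\le n$, be i.i.d. triples such that $\mu_i\sim G_\mu$ and $\sigma_i\sim G_\sigma$ are independent and $X_i\mid(\mu_i,\sigma_i)\sim N(\mu_i,\sigma_i^2)$. Assume that 1. $|\mu_i|\le C_n$ almost surely, where $C_n=o(n^\epsilon)$ for every $\epsilon>0$; 2. $\sigma_l\le\sigma_i\le\sigma_u$ almost surely, with constants $0<\sigma_l\le\sigma_u<\infty$ that do not depend on $n$. Let $h_x=h_{x,n}>0$ and $h_\sigma=h_{\sigma,n}>0$ be deterministic bandwidths of exact orders $n^{-\eta_x}$ and $n^{-\eta_s}$ (bounded above and below by positive constant multiples of these), where $\eta_x,\eta_s>0$ are constants that are small in the sense that $3\eta_x+\eta_s<1$ (in particular $0<\eta_x+\eta_s<1$). Put $$\hat f_{\sigma}(x)=\sum_{j=1}^n w_j(\sigma)\,\phi_{h_x\sigma_j}(x-X_j),\qquad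 w_j(\sigma)=\frac{\phi_{h_\sigma}(\sigma-\sigma_j)}{\sum_{k=1}^n\phi_{h_\sigma}(\sigma-\sigma_k)},$$ and let the truncated NEST estimator $\hat{\boldsymbol\delta}=(\hat\delta_1,\dots,\hat\delta_n)$ be $$\hat\delta_i=\max\Bigl\{-T_n,\ \min\Bigl\{T_n,\ X_i+\sigma_i^2\,\frac{\hat f_{\sigma_i}^{(1)}(X_i)}{\hat f_{\sigma_i}(X_i)}\Bigr\}\Bigr\},$$ where $\hat f^{(1)}_\sigma$ is the derivative of $\hat f_\sigma$ in $x$, and the truncation levels satisfy $T_n\ge C_n$ for all large $n$ and $T_n=o(n^\epsilon)$ for every $\epsilon>0$ (for example $T_n=C_n+\log n$, or $T_n=K\log n$ if $C_n\le K\log n$). Let $f_\sigma(x)=\int\phi_\sigma(x-\mu)\,dG_\mu(\mu)$, let $\delta^\pi(x,\sigma)=x+\sigma^2 f_\sigma^{(1)}(x)/f_\sigma(x)$ be the oracle rule, and let $(X,\mu,\sigma)$ be a generic triple of the model. Then the compound Bayes risk $r(\hat{\boldsymbol\delta},G)=\mathbb E\bigl\{n^{-1}\sum_{i=1}^n(\hat\delta_i-\mu_i)^2\bigr\}$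 and the oracle Bayes risk $r(\delta^\pi,G)=\mathbb E\bigl\{(\delta^\pi(X,\sigma)-\mu)^2\bigr\}$ are finite for every $n$, and $\hat{\boldsymbol\delta}$ is asymptotically optimal: $$\lim_{n\to\infty}\bigl\{r(\hat{\boldsymbol\delta},G)-r(\delta^\pi,G)\bigr\}=0 .$$ -/

import Mathlib

open MeasureTheory Filter Topology Asymptotics

noncomputable section

namespace NEST

/-- The Gaussian kernel `φ_h(z)`, the density at `z` of the normal law with mean `0` and standard
deviation `h` (for `h > 0`). -/
def phi (h z : ℝ) : ℝ :=
  1 / (Real.sqrt (2 * Real.pi) * h) * Real.exp (-z ^ 2 / (2 * h ^ 2))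

/-! ### The hierarchical model -/

/-- The joint law of a generic triple `(X, μ, σ)`: `μ ∼ Gμ` and `σ ∼ Gσ` are independent, and
`X` given `(μ, σ)` is normal with mean `μ` and variance `σ ^ 2`; that is, the law
`φ_σ(x - μ) dx dGμ(μ) dGσ(σ)`. -/
def tripleLaw (Gμ Gσ : Measure ℝ) : Measure (ℝ × ℝ × ℝ) :=
  ((volume : Measure ℝ).prod (Gμ.prod Gσ)).withDensity
    fun p => ENNReal.ofReal (phi p.2.2 (p.1 - p.2.1))

/-- The joint law of `n` independent triples `D i = (X i, μ i, σ i)`. -/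
def sampleLaw (n : ℕ) (Gμ Gσ : Measure ℝ) : Measure (Fin n → ℝ × ℝ × ℝ) :=
  Measure.pi fun _ => tripleLaw Gμ Gσ

/-! ### The oracle rule -/

/-- The marginal density `f_σ(x) = ∫ φ_σ(x - μ) dGμ(μ)`. -/
def marginal (Gμ : Measure ℝ) (σ x : ℝ) : ℝ :=
  ∫ m, phi σ (x - m) ∂Gμ

/-- The oracle (Bayes) rule `x + σ² f_σ'(x) / f_σ(x)`. -/
def oracle (Gμ : Measure ℝ) (x σ : ℝ) : ℝ :=
  x + σ ^ 2 * (deriv (marginal Gμ σ) x / marginal Gμ σ x)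

/-- The squared error of the oracle rule on a triple `(x, μ, σ)`. -/
def oracleLoss (Gμ : Measure ℝ) (p : ℝ × ℝ × ℝ) : ℝ :=
  (oracle Gμ p.1 p.2.2 - p.2.1) ^ 2

/-- The oracle Bayes risk `E (δ^π(X, σ) - μ)²`. -/
def oracleRisk (Gμ Gσ : Measure ℝ) : ℝ :=
  ∫ p, oracleLoss Gμ p ∂tripleLaw Gμ Gσ

/-! ### The NEST rule -/

/-- The weight of the `j`-th observation,
`φ_{hs}(σ - s j) / ∑ k, φ_{hs}(σ - s k)`. -/
def weight {n : ℕ} (hs : ℝ) (s : Fin n → ℝ) (σ : ℝ) (j : Fin n) : ℝ :=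
  phi hs (σ - s j) / ∑ k, phi hs (σ - s k)

/-- The weighted kernel density estimate of `f_σ` at `t`, from the observations `(x j, s j)`. -/
def kde {n : ℕ} (hx hs : ℝ) (x s : Fin n → ℝ) (σ t : ℝ) : ℝ :=
  ∑ j, weight hs s σ j * phi (hx * s j) (t - x j)

/-- The rule obtained by plugging the density estimate into Tweedie's formula. -/
def nestRaw {n : ℕ} (hx hs : ℝ) (x s : Fin n → ℝ) (i : Fin n) : ℝ :=
  x i + s i ^ 2 * (deriv (kde hx hs x s (s i)) (x i) / kde hx hs x s (s i) (x i))

/-- The truncated rule: each coordinate is clipped to the interval `[-T, T]`. -/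
def nest {n : ℕ} (T hx hs : ℝ) (x s : Fin n → ℝ) (i : Fin n) : ℝ :=
  max (-T) (min T (nestRaw hx hs x s i))

/-! ### Compound risk -/

/-- The compound loss `n⁻¹ ‖δ(x, s) - μ‖²` of a compound decision rule `δ`, as a function of
the full data. -/
def compoundLoss {n : ℕ} (δ : (Fin n → ℝ) → (Fin n → ℝ) → Fin n → ℝ)
    (D : Fin n → ℝ × ℝ × ℝ) : ℝ :=
  (n : ℝ)⁻¹ * ∑ i, (δ (fun j => (D j).1) (fun j => (D j).2.2) i - (D i).2.1) ^ 2

/-- The compound Bayes risk of a compound decision rule. -/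
def compoundRisk {n : ℕ} (δ : (Fin n → ℝ) → (Fin n → ℝ) → Fin n → ℝ)
    (Gμ Gσ : Measure ℝ) : ℝ :=
  ∫ D, compoundLoss δ D ∂sampleLaw n Gμ Gσ

end NEST

end

/-!
By Tweedie's formula the NEST rule is the oracle rule with the marginal density `f_σ` and its
derivative replaced by weighted kernel estimates. Given the standard deviations, the observations
are independent and `φ_{hx s j} * φ_{s j}` is the Gaussian density of standard deviation
`√(s j ^ 2 + (hx s j) ^ 2)`, so the kernel estimates at a fixed point have a bias governed by the
distance of this scale to `σ`, hence of order `hx + hs log n`, and a variance of order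
`max_j w_j / hx ^ (2 r + 1)`, where `r = 0, 1` is the order of the derivative. The standard
deviations lie in a bounded interval, which is covered by `O(1 / hs)` bins of width `hs`; an
observation carries at most a constant divided by the number of observations in its bin, so the
weights of the observations in their own estimates sum to `O(1 / hs)`, and the average error is a
negative power of `n` as soon as `3 ηx + ηs < 1`.

It remains to divide by the density. Where `f_σ ≥ R ^ (-2)`, the error of the clipped ratio is at
most a power of `R` times the error of the kernel estimates. A Gaussian mixture with means bounded
by `T` gives the set `f_σ < R ^ (-2)` mass `O(1 / R + T ^ 2 / R ^ 2)`, and there both rules are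
bounded by `T`. A small power `R` of `n` makes both contributions vanish.
-/

noncomputable section

namespace NEST

open ProbabilityTheory

/-! ### Gaussian kernels -/

/-- The derivative `φ_h'(z)` of the Gaussian kernel in `z`. -/
def dphi (h z : ℝ) : ℝ := -z / h ^ 2 * phi h z

lemma one_le_sqrt_two_pi : 1 ≤ √(2 * Real.pi) := by
  rw [Real.one_le_sqrt]; linarith [Real.two_le_pi]

lemma phi_pos {h : ℝ} (hh : 0 < h) (z : ℝ) : 0 < phi h z := by
  have := one_le_sqrt_two_pi
  unfold phi; positivity

lemma phi_eq_phi_one_div (h z : ℝ) : phi h z = phi 1 (z / h) / h := by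
  unfold phi
  rw [mul_one, one_pow, mul_one, div_pow, neg_div, neg_div, div_div, mul_comm 2 (h ^ 2)]
  ring

lemma phi_one_le_exp (u : ℝ) : phi 1 u ≤ Real.exp (-(u ^ 2 / 2)) := by
  unfold phi
  rw [one_pow, mul_one, mul_one, neg_div]
  exact mul_le_of_le_one_left (Real.exp_pos _).le
    (div_le_one_of_le₀ one_le_sqrt_two_pi (Real.sqrt_nonneg _))

lemma phi_one_le_one (u : ℝ) : phi 1 u ≤ 1 :=
  (phi_one_le_exp u).trans (Real.exp_le_one_iff.2 (by linarith [sq_nonneg u]))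

lemma mul_exp_neg_le_half (t : ℝ) : t * Real.exp (-t) ≤ 1 / 2 := by
  refine (Real.mul_exp_neg_le_exp_neg_one t).trans ?_
  rw [Real.exp_neg, ← one_div]
  exact one_div_le_one_div_of_le two_pos (by linarith [Real.add_one_le_exp 1])

lemma sq_mul_phi_one_le (u : ℝ) : u ^ 2 * phi 1 u ≤ 1 := by
  calc u ^ 2 * phi 1 u ≤ u ^ 2 * Real.exp (-(u ^ 2 / 2)) := by gcongr; exact phi_one_le_exp u
    _ = 2 * (u ^ 2 / 2 * Real.exp (-(u ^ 2 / 2))) := by ring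
    _ ≤ 1 := by linarith [mul_exp_neg_le_half (u ^ 2 / 2)]

lemma pow_four_mul_phi_one_le (u : ℝ) : u ^ 4 * phi 1 u ≤ 4 := by
  calc u ^ 4 * phi 1 u ≤ u ^ 4 * Real.exp (-(u ^ 2 / 2)) := by gcongr; exact phi_one_le_exp u
    _ = 16 * (u ^ 2 / 4 * Real.exp (-(u ^ 2 / 4))) ^ 2 := by
        rw [mul_pow, ← Real.exp_nat_mul]; ring_nf
    _ ≤ 16 * (1 / 2) ^ 2 := by gcongr; exact mul_exp_neg_le_half _
    _ = 4 := by norm_num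

lemma abs_mul_phi_one_le (u : ℝ) : |u * phi 1 u| ≤ 1 := by
  refine abs_le_of_sq_le_sq ?_ zero_le_one
  calc (u * phi 1 u) ^ 2 = u ^ 2 * phi 1 u * phi 1 u := by ring
    _ ≤ 1 * 1 := mul_le_mul (sq_mul_phi_one_le u) (phi_one_le_one u)
        (phi_pos one_pos u).le zero_le_one
    _ = 1 ^ 2 := by norm_num

lemma abs_cube_mul_phi_one_le (u : ℝ) : |u ^ 3 * phi 1 u| ≤ 2 := by
  refine abs_le_of_sq_le_sq ?_ zero_le_two
  calc (u ^ 3 * phi 1 u) ^ 2 = u ^ 2 * phi 1 u * (u ^ 4 * phi 1 u) := by ring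
    _ ≤ 1 * 4 := mul_le_mul (sq_mul_phi_one_le u) (pow_four_mul_phi_one_le u)
        (mul_nonneg (by positivity) (phi_pos one_pos u).le) zero_le_one
    _ = 2 ^ 2 := by norm_num

lemma hasDerivAt_phi (h z : ℝ) : HasDerivAt (phi h) (dphi h z) z := by
  have hexp : HasDerivAt (fun z : ℝ => -z ^ 2 / (2 * h ^ 2)) (-z / h ^ 2) z :=
    ((hasDerivAt_pow 2 z).neg.div_const (2 * h ^ 2)).congr_deriv (by push_cast; ring)
  exact (hexp.exp.const_mul (1 / (√(2 * Real.pi) * h))).congr_deriv (by unfold dphi phi; ring)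

lemma hasDerivAt_phi_scale {h : ℝ} (hh : h ≠ 0) (z : ℝ) :
    HasDerivAt (fun h => phi h z) (phi h z * (z ^ 2 / h ^ 3 - 1 / h)) h := by
  have hc : √(2 * Real.pi) ≠ 0 := by linarith [one_le_sqrt_two_pi]
  have hexp : HasDerivAt (fun h : ℝ => -z ^ 2 / (2 * h ^ 2)) (z ^ 2 / h ^ 3) h := by
    refine ((hasDerivAt_const h (-z ^ 2)).div ((hasDerivAt_pow 2 h).const_mul 2)
      (by positivity)).congr_deriv ?_
    field_simp; ring
  have hnorm : HasDerivAt (fun h : ℝ => 1 / (√(2 * Real.pi) * h))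
      (-(1 / (√(2 * Real.pi) * h)) / h) h := by
    refine ((hasDerivAt_const h (1 : ℝ)).div ((hasDerivAt_id h).const_mul _)
      (mul_ne_zero hc hh)).congr_deriv ?_
    simp only [id]; field_simp; norm_num
  exact (hnorm.mul hexp.exp).congr_deriv (by unfold phi; ring)

lemma hasDerivAt_dphi_scale {h : ℝ} (hh : h ≠ 0) (z : ℝ) :
    HasDerivAt (fun h => dphi h z) (z * phi h z / h ^ 3 * (3 - z ^ 2 / h ^ 2)) h := by
  have hfac : HasDerivAt (fun h : ℝ => -z / h ^ 2) (2 * z / h ^ 3) h := by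
    refine ((hasDerivAt_const h (-z)).div (hasDerivAt_pow 2 h) (by positivity)).congr_deriv ?_
    field_simp; ring
  refine (hfac.mul (hasDerivAt_phi_scale hh z)).congr_deriv ?_
  field_simp; ring

lemma abs_sub_le_of_abs_deriv_scale_le {f f' : ℝ → ℝ} {c a s t : ℝ} {p : ℕ} (hc : 0 ≤ c)
    (ha : 0 < a) (hs : a ≤ s) (ht : a ≤ t) (hf : ∀ h, 0 < h → HasDerivAt f (f' h) h)
    (hf' : ∀ h, 0 < h → |f' h| ≤ c / h ^ p) : |f s - f t| ≤ c / a ^ p * |s - t| := by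
  refine Convex.norm_image_sub_le_of_norm_hasDerivWithin_le (s := Set.Ici a)
    (fun h hh => (hf h (ha.trans_le hh)).hasDerivWithinAt)
    (fun h hh => (hf' h (ha.trans_le hh)).trans ?_) (convex_Ici a) ht hs
  have : a ≤ h := hh
  gcongr

/-- `k h` behaves like the `r`-th derivative of the Gaussian kernel `φ_h`, with the same constant
`A` in all bounds. The theorem needs the kernels `φ_h` and `φ_h'`, which are treated alike. -/
structure IsGaussianKernel (r : ℕ) (A : ℝ) (k : ℝ → ℝ → ℝ) : Prop where
  measurable : Measurable fun p : ℝ × ℝ => k p.1 p.2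
  abs_le : ∀ {h : ℝ}, 0 < h → ∀ z, |k h z| ≤ A / h ^ (r + 1)
  sq_le : ∀ {h : ℝ}, 0 < h → ∀ z, k h z ^ 2 ≤ A / h ^ (2 * r + 1) * phi h z
  conv : ∀ {h s : ℝ}, 0 < h → 0 < s → ∀ u,
    ∫ z, k h (u - s * z) ∂(gaussianReal 0 1) = k (√(s ^ 2 + h ^ 2)) u
  lipschitz : ∀ {a s t : ℝ}, 0 < a → a ≤ s → a ≤ t → ∀ z,
    |k s z - k t z| ≤ A / a ^ (r + 2) * |s - t|

lemma IsGaussianKernel.const_nonneg {r : ℕ} {A : ℝ} {k : ℝ → ℝ → ℝ} (hk : IsGaussianKernel r A k) :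
    0 ≤ A := by
  simpa using (abs_nonneg _).trans (hk.abs_le one_pos 0)

lemma measurable_phi : Measurable fun p : ℝ × ℝ => phi p.1 p.2 := by
  unfold phi; fun_prop

lemma measurable_dphi : Measurable fun p : ℝ × ℝ => dphi p.1 p.2 := by
  unfold dphi phi; fun_prop

lemma abs_phi_le (h z : ℝ) : |phi h z| ≤ 1 / |h| := by
  rw [phi_eq_phi_one_div, abs_div, abs_of_pos (phi_pos one_pos _)]
  gcongr
  exact phi_one_le_one _

lemma phi_le {h : ℝ} (hh : 0 < h) (z : ℝ) : phi h z ≤ 1 / h := by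
  simpa only [abs_of_pos (phi_pos hh z), abs_of_pos hh] using abs_phi_le h z

lemma dphi_sq_le {h : ℝ} (hh : 0 < h) (z : ℝ) : dphi h z ^ 2 ≤ 1 / h ^ 3 * phi h z := by
  have h1 := sq_mul_phi_one_le (z / h)
  have hp := phi_pos hh z
  calc dphi h z ^ 2 = (z / h) ^ 2 * phi 1 (z / h) / h ^ 3 * phi h z := by
        unfold dphi; nth_rw 1 [pow_two]; nth_rw 1 [phi_eq_phi_one_div]; field_simp
    _ ≤ 1 / h ^ 3 * phi h z := by gcongr

lemma abs_dphi_le (h z : ℝ) : |dphi h z| ≤ 1 / h ^ 2 := by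
  have hscale : dphi h z = -(z / h * phi 1 (z / h)) / h ^ 2 := by
    rw [dphi, phi_eq_phi_one_div]; ring
  rw [hscale, abs_div, abs_neg, abs_of_nonneg (sq_nonneg h)]
  gcongr
  exact abs_mul_phi_one_le _

lemma abs_phi_sub_le {a s t : ℝ} (ha : 0 < a) (hs : a ≤ s) (ht : a ≤ t) (z : ℝ) :
    |phi s z - phi t z| ≤ 1 / a ^ 2 * |s - t| := by
  refine abs_sub_le_of_abs_deriv_scale_le (f := fun h => phi h z) zero_le_one ha hs ht
    (fun h hh => hasDerivAt_phi_scale hh.ne' z) fun h hh => ?_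
  have hscale : phi h z * (z ^ 2 / h ^ 3 - 1 / h)
      = ((z / h) ^ 2 * phi 1 (z / h) - phi 1 (z / h)) / h ^ 2 := by
    rw [phi_eq_phi_one_div]; field_simp
  rw [hscale, abs_div, abs_of_pos (by positivity : 0 < h ^ 2)]
  have h0 := (phi_pos one_pos (z / h)).le
  have h1 := phi_one_le_one (z / h)
  have h2 := sq_mul_phi_one_le (z / h)
  have h3 : 0 ≤ (z / h) ^ 2 * phi 1 (z / h) := by positivity
  gcongr
  exact abs_le.2 ⟨by linarith, by linarith⟩

lemma abs_dphi_sub_le {a s t : ℝ} (ha : 0 < a) (hs : a ≤ s) (ht : a ≤ t) (z : ℝ) :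
    |dphi s z - dphi t z| ≤ 5 / a ^ 3 * |s - t| := by
  refine abs_sub_le_of_abs_deriv_scale_le (f := fun h => dphi h z) (by norm_num) ha hs ht
    (fun h hh => hasDerivAt_dphi_scale hh.ne' z) fun h hh => ?_
  have hscale : z * phi h z / h ^ 3 * (3 - z ^ 2 / h ^ 2)
      = (3 * (z / h * phi 1 (z / h)) - (z / h) ^ 3 * phi 1 (z / h)) / h ^ 3 := by
    rw [phi_eq_phi_one_div]; field_simp
  rw [hscale, abs_div, abs_of_pos (by positivity : 0 < h ^ 3)]
  have h1 := abs_le.1 (abs_mul_phi_one_le (z / h))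
  have h2 := abs_le.1 (abs_cube_mul_phi_one_le (z / h))
  gcongr
  exact abs_le.2 ⟨by linarith, by linarith⟩

lemma phi_sub_eq_gaussianPDFReal {s : ℝ} (hs : 0 < s) (m x : ℝ) :
    phi s (x - m) = gaussianPDFReal m (s ^ 2).toNNReal x := by
  unfold phi gaussianPDFReal
  rw [Real.coe_toNNReal _ (sq_nonneg s), Real.sqrt_mul (by positivity) (s ^ 2),
    Real.sqrt_sq hs.le, one_div]

lemma integral_phi {s : ℝ} (hs : 0 < s) (m : ℝ) : ∫ x, phi s (x - m) = 1 := by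
  simp_rw [phi_sub_eq_gaussianPDFReal hs]
  exact integral_gaussianPDFReal_eq_one _ (by simpa using hs.ne')

lemma integral_phi_gaussianReal {h s : ℝ} (hh : 0 < h) (hs : 0 < s) (u : ℝ) :
    ∫ z, phi h (u - s * z) ∂(gaussianReal 0 1) = phi (√(s ^ 2 + h ^ 2)) u := by
  rw [integral_gaussianReal_eq_integral_smul (by norm_num)]
  set r := √(s ^ 2 + h ^ 2)
  have hr0 : 0 < r := by positivity
  have hr2 : r ^ 2 = s ^ 2 + h ^ 2 := Real.sq_sqrt (by positivity)
  have complete_square : ∀ z, gaussianPDFReal 0 1 z • phi h (u - s * z)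
      = phi r u * phi (h / r) (z - s * u / r ^ 2) := by
    intro z
    have hpdf : gaussianPDFReal 0 1 z = phi 1 z := by
      rw [← sub_zero z, phi_sub_eq_gaussianPDFReal one_pos]; simp
    have hexp : -z ^ 2 / (2 * 1 ^ 2) + -(u - s * z) ^ 2 / (2 * h ^ 2)
        = -u ^ 2 / (2 * r ^ 2) + -(z - s * u / r ^ 2) ^ 2 / (2 * (h / r) ^ 2) := by
      field_simp
      simp only [hr2]; ring
    have hexp' := congrArg Real.exp hexp
    rw [Real.exp_add, Real.exp_add] at hexp'
    rw [hpdf, smul_eq_mul]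
    unfold phi
    have := one_le_sqrt_two_pi
    calc _ = 1 / (√(2 * Real.pi) * √(2 * Real.pi) * h) *
          (Real.exp (-z ^ 2 / (2 * 1 ^ 2)) * Real.exp (-(u - s * z) ^ 2 / (2 * h ^ 2))) := by
          field_simp
      _ = _ := by rw [hexp']; field_simp
  simp_rw [complete_square]
  rw [integral_const_mul, integral_phi (by positivity), mul_one]

lemma measurable_comp_kernel {k : ℝ → ℝ → ℝ} (hk : Measurable fun p : ℝ × ℝ => k p.1 p.2) (h : ℝ) :
    Measurable (k h) :=
  hk.comp measurable_prodMk_left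

lemma hasDerivAt_integral_phi {Ω : Type*} [MeasurableSpace Ω] (P : Measure Ω) [IsFiniteMeasure P]
    {Y : Ω → ℝ} (hY : Measurable Y) (h u : ℝ) :
    HasDerivAt (fun u => ∫ ω, phi h (u - Y ω) ∂P) (∫ ω, dphi h (u - Y ω) ∂P) u := by
  have hm (x : ℝ) : Measurable fun ω => phi h (x - Y ω) :=
    (measurable_comp_kernel measurable_phi h).comp (by fun_prop)
  have hm' : Measurable fun ω => dphi h (u - Y ω) :=
    (measurable_comp_kernel measurable_dphi h).comp (by fun_prop)
  exact (hasDerivAt_integral_of_dominated_loc_of_deriv_le (bound := fun _ => 1 / h ^ 2) univ_mem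
    (Eventually.of_forall fun x => (hm x).aestronglyMeasurable)
    (.of_bound (hm u).aestronglyMeasurable (1 / |h|) (ae_of_all _ fun _ => abs_phi_le h _))
    hm'.aestronglyMeasurable (ae_of_all _ fun _ _ _ => abs_dphi_le h _)
    (integrable_const _)
    (ae_of_all _ fun _ _ _ => (hasDerivAt_phi h _).comp_sub_const _ _)).2

lemma integral_dphi_gaussianReal {h s : ℝ} (hh : 0 < h) (hs : 0 < s) (u : ℝ) :
    ∫ z, dphi h (u - s * z) ∂(gaussianReal 0 1) = dphi (√(s ^ 2 + h ^ 2)) u := by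
  have hderiv := hasDerivAt_integral_phi (gaussianReal 0 1) (measurable_const_mul s) h u
  simp_rw [integral_phi_gaussianReal hh hs] at hderiv
  exact hderiv.unique (hasDerivAt_phi _ u)

lemma isGaussianKernel_phi : IsGaussianKernel 0 1 phi where
  measurable := measurable_phi
  abs_le {h} hh z := by simpa [abs_of_pos hh] using abs_phi_le h z
  sq_le {h} hh z := by
    simpa [pow_two] using mul_le_mul_of_nonneg_right (phi_le hh z) (phi_pos hh z).le
  conv := integral_phi_gaussianReal
  lipschitz ha hs ht := abs_phi_sub_le ha hs ht

lemma isGaussianKernel_dphi : IsGaussianKernel 1 5 dphi where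
  measurable := measurable_dphi
  abs_le {h} hh z := (abs_dphi_le h z).trans (by gcongr; norm_num)
  sq_le {h} hh z := (dphi_sq_le hh z).trans (by
    have := phi_pos hh z
    gcongr; norm_num)
  conv := integral_dphi_gaussianReal
  lipschitz ha hs ht := abs_dphi_sub_le ha hs ht

/-! ### Mixtures and the oracle rule -/

/-- The mixture `∫ k_σ(x - μ) dG(μ)` of a kernel over the means; for `k = phi` this is the marginal
density `f_σ`, and for `k = dphi` its derivative. -/
def mixture (k : ℝ → ℝ → ℝ) (G : Measure ℝ) (σ x : ℝ) : ℝ := ∫ m, k σ (x - m) ∂G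

section Mixture

variable {r : ℕ} {A σ : ℝ} {k : ℝ → ℝ → ℝ} {G : Measure ℝ}

lemma measurable_mixture [SFinite G] (hk : Measurable fun p : ℝ × ℝ => k p.1 p.2) :
    Measurable fun p : ℝ × ℝ => mixture k G p.1 p.2 := by
  have : StronglyMeasurable fun q : (ℝ × ℝ) × ℝ => k q.1.1 (q.1.2 - q.2) :=
    (hk.comp (by fun_prop : Measurable fun q : (ℝ × ℝ) × ℝ =>
      (q.1.1, q.1.2 - q.2))).stronglyMeasurable
  exact (this.integral_prod_right (ν := G)).measurable

lemma IsGaussianKernel.integrable_sub [IsFiniteMeasure G] (hk : IsGaussianKernel r A k)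
    (hσ : 0 < σ) (x : ℝ) : Integrable (fun m => k σ (x - m)) G :=
  .of_bound ((measurable_comp_kernel hk.measurable σ).comp (by fun_prop)).aestronglyMeasurable
    (A / σ ^ (r + 1)) (ae_of_all _ fun _ => hk.abs_le hσ _)

variable [IsProbabilityMeasure G]

lemma IsGaussianKernel.abs_mixture_le (hk : IsGaussianKernel r A k) (hσ : 0 < σ) (x : ℝ) :
    |mixture k G σ x| ≤ A / σ ^ (r + 1) := by
  simpa [mixture] using norm_integral_le_of_norm_le_const (μ := G) (f := fun m => k σ (x - m))
    (C := A / σ ^ (r + 1)) (ae_of_all _ fun _ => hk.abs_le hσ _)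

lemma IsGaussianKernel.abs_mixture_sub_le (hk : IsGaussianKernel r A k) {a s t : ℝ} (ha : 0 < a)
    (hs : a ≤ s) (ht : a ≤ t) (x : ℝ) :
    |mixture k G s x - mixture k G t x| ≤ A / a ^ (r + 2) * |s - t| := by
  rw [mixture, mixture, ← integral_sub (hk.integrable_sub (ha.trans_le hs) x)
    (hk.integrable_sub (ha.trans_le ht) x)]
  simpa using norm_integral_le_of_norm_le_const (μ := G)
    (f := fun m => k s (x - m) - k t (x - m)) (ae_of_all _ fun _ => hk.lipschitz ha hs ht _)

lemma deriv_marginal (σ x : ℝ) : deriv (marginal G σ) x = mixture dphi G σ x :=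
  (hasDerivAt_integral_phi G measurable_id σ x).deriv

lemma marginal_pos (hσ : 0 < σ) (x : ℝ) : 0 < marginal G σ x := by
  refine (integral_pos_iff_support_of_nonneg (fun m => (phi_pos hσ _).le)
    (isGaussianKernel_phi.integrable_sub hσ x)).2 ?_
  have : Function.support (fun m => phi σ (x - m)) = Set.univ :=
    Set.eq_univ_of_forall fun m => (phi_pos hσ _).ne'
  simp [this]

lemma oracle_mul_marginal (hσ : 0 < σ) (x : ℝ) :
    oracle G x σ * marginal G σ x = ∫ m, m * phi σ (x - m) ∂G := by
  have hp := marginal_pos (G := G) hσ x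
  calc oracle G x σ * marginal G σ x
      = x * marginal G σ x + σ ^ 2 * mixture dphi G σ x := by
        rw [oracle, deriv_marginal]; field_simp
    _ = ∫ m, x * phi σ (x - m) + σ ^ 2 * dphi σ (x - m) ∂G := by
        rw [marginal, mixture, integral_add
          ((isGaussianKernel_phi.integrable_sub hσ x).const_mul _)
          ((isGaussianKernel_dphi.integrable_sub hσ x).const_mul _),
          integral_const_mul, integral_const_mul]
    _ = ∫ m, m * phi σ (x - m) ∂G := by
        congr with m
        unfold dphi; field_simp; ring

lemma abs_oracle_le {C : ℝ} (hσ : 0 < σ) (hC : ∀ᵐ m ∂G, |m| ≤ C) (x : ℝ) :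
    |oracle G x σ| ≤ C := by
  have hp := marginal_pos (G := G) hσ x
  refine le_of_mul_le_mul_right ?_ hp
  rw [← abs_of_pos hp, ← abs_mul, abs_of_pos hp, oracle_mul_marginal hσ, marginal,
    ← integral_const_mul, ← Real.norm_eq_abs]
  refine norm_integral_le_of_norm_le ((isGaussianKernel_phi.integrable_sub hσ x).const_mul C) ?_
  filter_upwards [hC] with m hm
  rw [norm_mul, Real.norm_eq_abs, Real.norm_eq_abs, abs_of_pos (phi_pos hσ _)]
  exact mul_le_mul_of_nonneg_right hm (phi_pos hσ _).le

lemma measurable_oracle : Measurable fun p : ℝ × ℝ => oracle G p.1 p.2 := by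
  have hphi := (measurable_mixture (G := G) measurable_phi).comp measurable_swap
  have hdphi := (measurable_mixture (G := G) measurable_dphi).comp measurable_swap
  unfold oracle
  simp_rw [deriv_marginal]
  exact measurable_fst.add ((measurable_snd.pow_const 2).mul (hdphi.div hphi))

end Mixture

/-! ### The weights -/

lemma sum_one_div_card_fiber_le {ι κ : Type*} [Fintype ι] [DecidableEq κ] (f : ι → κ)
    (t : Finset κ) (hf : ∀ i, f i ∈ t) :
    ∑ i, 1 / ((Finset.univ.filter fun j => f j = f i).card : ℝ) ≤ t.card := by
  rw [← Finset.sum_fiberwise_of_maps_to (fun i _ => hf i)]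
  calc _ ≤ ∑ _c ∈ t, (1 : ℝ) := Finset.sum_le_sum fun c _ => ?_
    _ = t.card := by simp
  calc _ = ∑ i with f i = c, 1 / ((Finset.univ.filter fun j => f j = c).card : ℝ) :=
        Finset.sum_congr rfl fun i hi => by rw [(Finset.mem_filter.1 hi).2]
    _ ≤ 1 := by
        rw [Finset.sum_const, nsmul_eq_mul, mul_one_div]
        exact div_self_le_one _

lemma abs_sub_le_of_floor_eq {x y h : ℝ} (hh : 0 < h) (hx : 0 ≤ x) (hy : 0 ≤ y)
    (hxy : ⌊x / h⌋₊ = ⌊y / h⌋₊) : |x - y| ≤ h := by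
  have hfloor {z : ℝ} (hz : 0 ≤ z) : h * ⌊z / h⌋₊ ≤ z ∧ z ≤ h * ⌊z / h⌋₊ + h := by
    have h1 := Nat.floor_le (div_nonneg hz hh.le)
    have h2 := (Nat.lt_floor_add_one (z / h)).le
    rw [le_div_iff₀ hh] at h1
    rw [div_le_iff₀ hh] at h2
    constructor <;> linarith
  have h1 := hfloor hx
  have h2 := hfloor hy
  rw [hxy] at h1
  exact abs_le.2 ⟨by linarith, by linarith⟩

section Weight

variable {n : ℕ} {hs : ℝ}

lemma weight_nonneg (hs0 : 0 < hs) (s : Fin n → ℝ) (σ : ℝ) (j : Fin n) : 0 ≤ weight hs s σ j :=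
  div_nonneg (phi_pos hs0 _).le (Finset.sum_nonneg fun _ _ => (phi_pos hs0 _).le)

lemma abs_sum_weight_mul_le (hs0 : 0 < hs) (s : Fin n → ℝ) (σ : ℝ) {a b : Fin n → ℝ}
    (hab : ∀ j, |a j| ≤ b j) :
    |∑ j, weight hs s σ j * a j| ≤ ∑ j, weight hs s σ j * b j := by
  refine (Finset.abs_sum_le_sum_abs _ _).trans (Finset.sum_le_sum fun j _ => ?_)
  rw [abs_mul, abs_of_nonneg (weight_nonneg hs0 s σ j)]
  exact mul_le_mul_of_nonneg_left (hab j) (weight_nonneg hs0 s σ j)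

variable (s : Fin n → ℝ) (i : Fin n)

lemma sum_weight (hs0 : 0 < hs) : ∑ j, weight hs s (s i) j = 1 := by
  have hpos : 0 < ∑ k, phi hs (s i - s k) :=
    Finset.sum_pos (fun _ _ => phi_pos hs0 _) ⟨i, Finset.mem_univ i⟩
  simp_rw [weight, ← Finset.sum_div]
  exact div_self hpos.ne'

lemma weight_mul_exp (j : Fin n) :
    weight hs s (s i) j * Real.exp ((s i - s j) ^ 2 / (2 * hs ^ 2)) = weight hs s (s i) i := by
  rw [weight, weight, div_mul_eq_mul_div]
  congr 1
  rw [phi, phi, mul_assoc, ← Real.exp_add, sub_self]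
  ring_nf

lemma weight_le_weight_self (hs0 : 0 < hs) (j : Fin n) :
    weight hs s (s i) j ≤ weight hs s (s i) i := by
  rw [← weight_mul_exp s i j]
  exact le_mul_of_one_le_right (weight_nonneg hs0 s _ j) (Real.one_le_exp (by positivity))

lemma weight_le_one (hs0 : 0 < hs) (j : Fin n) : weight hs s (s i) j ≤ 1 :=
  (Finset.single_le_sum (fun j _ => weight_nonneg hs0 s _ j) (Finset.mem_univ j)).trans_eq
    (sum_weight s i hs0)

lemma sum_weight_sq_le (hs0 : 0 < hs) :
    ∑ j, weight hs s (s i) j ^ 2 ≤ weight hs s (s i) i := by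
  calc _ ≤ ∑ j, weight hs s (s i) j * weight hs s (s i) i := by
        refine Finset.sum_le_sum fun j _ => ?_
        rw [sq]
        exact mul_le_mul_of_nonneg_left (weight_le_weight_self s i hs0 j) (weight_nonneg hs0 s _ j)
    _ = _ := by rw [← Finset.sum_mul, sum_weight s i hs0, one_mul]

-- Jensen for `exp`, as the weights times `exp ((s i - s j)² / (2 hs²))` are constant in `j`
lemma sum_weight_mul_sq_le (hs0 : 0 < hs) :
    ∑ j, weight hs s (s i) j * ((s i - s j) ^ 2 / (2 * hs ^ 2)) ≤ Real.log n := by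
  have hn : (0 : ℝ) < n := by exact_mod_cast i.pos
  rw [Real.le_log_iff_exp_le hn]
  calc _ ≤ ∑ j, weight hs s (s i) j * Real.exp ((s i - s j) ^ 2 / (2 * hs ^ 2)) := by
        simpa only [smul_eq_mul] using convexOn_exp.map_sum_le
          (fun j _ => weight_nonneg hs0 s (s i) j) (sum_weight s i hs0) fun _ _ => Set.mem_univ _
    _ = n * weight hs s (s i) i := by simp [weight_mul_exp]
    _ ≤ n := mul_le_of_le_one_right hn.le (weight_le_one s i hs0 i)

lemma sum_weight_mul_abs_le (hs0 : 0 < hs) :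
    ∑ j, weight hs s (s i) j * |s i - s j| ≤ hs * (Real.log n + 1) := by
  have young (d : ℝ) : |d| ≤ hs * (d ^ 2 / (2 * hs ^ 2) + 1) := by
    have : hs * (d ^ 2 / (2 * hs ^ 2) + 1) = (d ^ 2 + 2 * hs ^ 2) / (2 * hs) := by field_simp
    rw [this, le_div_iff₀ (by positivity), ← sq_abs]
    nlinarith [sq_nonneg (|d| - hs)]
  calc _ ≤ ∑ j, weight hs s (s i) j * (hs * ((s i - s j) ^ 2 / (2 * hs ^ 2) + 1)) := by
        gcongr with j
        exacts [weight_nonneg hs0 s _ j, young _]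
    _ = hs * (∑ j, weight hs s (s i) j * ((s i - s j) ^ 2 / (2 * hs ^ 2)) + 1) := by
        rw [← sum_weight s i hs0, ← Finset.sum_add_distrib, Finset.mul_sum]
        exact Finset.sum_congr rfl fun j _ => by rw [sum_weight s i hs0]; ring
    _ ≤ _ := by gcongr; exact sum_weight_mul_sq_le s i hs0

lemma weight_self_le_two_div_card (hs0 : 0 < hs) {t : Finset (Fin n)} (ht : t.Nonempty)
    (hclose : ∀ j ∈ t, |s i - s j| ≤ hs) : weight hs s (s i) i ≤ 2 / t.card := by
  have hhalf : ∀ j ∈ t, weight hs s (s i) i / 2 ≤ weight hs s (s i) j := fun j hj => by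
    have hexp : Real.exp ((s i - s j) ^ 2 / (2 * hs ^ 2)) ≤ 2 := by
      rw [← Real.le_log_iff_exp_le two_pos, div_le_iff₀ (by positivity), ← sq_abs]
      calc |s i - s j| ^ 2 ≤ hs ^ 2 := by gcongr; exact hclose j hj
        _ ≤ Real.log 2 * (2 * hs ^ 2) := by nlinarith [Real.log_two_gt_d9, sq_nonneg hs]
    have := mul_le_mul_of_nonneg_left hexp (weight_nonneg hs0 s (s i) j)
    rw [weight_mul_exp] at this
    linarith
  have hsum : t.card * (weight hs s (s i) i / 2) ≤ 1 := by
    rw [← nsmul_eq_mul, ← sum_weight s i hs0]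
    exact (Finset.card_nsmul_le_sum t _ _ hhalf).trans (Finset.sum_le_sum_of_subset_of_nonneg
      (Finset.subset_univ t) fun j _ _ => weight_nonneg hs0 s _ j)
  rw [le_div_iff₀ (by exact_mod_cast ht.card_pos)]
  linarith

lemma sum_weight_self_le (hs0 : 0 < hs) {a b : ℝ} (hab : a ≤ b) (hsab : ∀ i, a ≤ s i ∧ s i ≤ b) :
    ∑ i, weight hs s (s i) i ≤ 2 * ((b - a) / hs + 1) := by
  let bin : Fin n → ℕ := fun i => ⌊(s i - a) / hs⌋₊
  have hclose (i : Fin n) : ∀ j ∈ Finset.univ.filter (fun j => bin j = bin i),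
      |s i - s j| ≤ hs := fun j hj => by
    simpa using abs_sub_le_of_floor_eq hs0 (sub_nonneg.2 (hsab i).1) (sub_nonneg.2 (hsab j).1)
      (Finset.mem_filter.1 hj).2.symm
  have hbin (i : Fin n) : bin i ∈ Finset.range (⌊(b - a) / hs⌋₊ + 1) := by
    rw [Finset.mem_range, Nat.lt_succ_iff]
    exact Nat.floor_le_floor (by gcongr; exact (hsab i).2)
  calc _ ≤ ∑ i, 2 * (1 / ((Finset.univ.filter fun j => bin j = bin i).card : ℝ)) := by
        refine Finset.sum_le_sum fun i _ => ?_
        rw [mul_one_div]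
        exact weight_self_le_two_div_card s i hs0 ⟨i, by simp⟩ (hclose i)
    _ ≤ 2 * (⌊(b - a) / hs⌋₊ + 1) := by
        rw [← Finset.mul_sum]
        gcongr
        simpa using sum_one_div_card_fiber_le bin _ hbin
    _ ≤ _ := by
        gcongr; exact Nat.floor_le (div_nonneg (sub_nonneg.2 hab) hs0.le)

end Weight

/-! ### Laws of the observations -/

/-- The triple `(X, μ, σ)` with `X = μ + σ z` that is generated by the standardized noise and mean
`ω = (z, μ)` and the standard deviation `σ`. -/
def triple (ω : ℝ × ℝ) (σ : ℝ) : ℝ × ℝ × ℝ := (ω.2 + σ * ω.1, ω.2, σ)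

/-- The joint law of the standardized noise and the mean. -/
def noiseLaw (G : Measure ℝ) : Measure (ℝ × ℝ) := (gaussianReal 0 1).prod G

/-- The conditional law of an observation `X` given its standard deviation `σ`. -/
def obsLaw (G : Measure ℝ) (σ : ℝ) : Measure ℝ := (noiseLaw G).map fun ω => (triple ω σ).1

section Laws

variable {G Gσ : Measure ℝ}

lemma measurable_triple : Measurable fun q : (ℝ × ℝ) × ℝ => triple q.1 q.2 := by
  unfold triple; fun_prop

lemma measurable_triple_fst (σ : ℝ) : Measurable fun ω : ℝ × ℝ => (triple ω σ).1 := by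
  unfold triple; fun_prop

lemma gaussianReal_map_affine (m σ : ℝ) :
    (gaussianReal 0 1).map (fun z => m + σ * z) = gaussianReal m (σ ^ 2).toNNReal := by
  have hcomp : (gaussianReal 0 1).map (fun z => m + σ * z)
      = ((gaussianReal 0 1).map (σ * ·)).map (m + ·) := by
    rw [Measure.map_map (by fun_prop) (by fun_prop)]; rfl
  rw [hcomp, gaussianReal_map_const_mul, gaussianReal_map_const_add]
  congr 1
  · simp
  · rw [mul_one]; ext; simp [Real.coe_toNNReal _ (sq_nonneg σ)]

lemma setLIntegral_phi {σ : ℝ} (hσ : 0 < σ) (m : ℝ) {S : Set ℝ} (hS : MeasurableSet S) :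
    ∫⁻ x in S, ENNReal.ofReal (phi σ (x - m)) = gaussianReal 0 1 ((fun z => m + σ * z) ⁻¹' S) := by
  rw [← Measure.map_apply (by fun_prop) hS, gaussianReal_map_affine,
    gaussianReal_apply _ (by simpa using hσ.ne')]
  simp_rw [phi_sub_eq_gaussianPDFReal hσ, gaussianPDF]

lemma ae_tripleLaw [SFinite Gσ] {p q : ℝ → Prop} (hp : ∀ᵐ m ∂G, p m) (hq : ∀ᵐ σ ∂Gσ, q σ) :
    ∀ᵐ t ∂tripleLaw G Gσ, p t.2.1 ∧ q t.2.2 :=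
  (withDensity_absolutelyContinuous _ _).ae_le <| Measure.quasiMeasurePreserving_snd.ae <|
    (Measure.quasiMeasurePreserving_fst.ae hp).and (Measure.quasiMeasurePreserving_snd.ae hq)

variable [IsProbabilityMeasure G] [IsProbabilityMeasure Gσ]

instance : IsProbabilityMeasure (noiseLaw G) := by
  unfold noiseLaw; infer_instance

instance (σ : ℝ) : IsProbabilityMeasure (obsLaw G σ) :=
  Measure.isProbabilityMeasure_map (measurable_triple_fst σ).aemeasurable

lemma tripleLaw_eq_map (hσ : ∀ᵐ σ ∂Gσ, 0 < σ) :
    tripleLaw G Gσ = ((noiseLaw G).prod Gσ).map fun q => triple q.1 q.2 := by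
  have hm : Measurable fun p : ℝ × ℝ × ℝ => ENNReal.ofReal (phi p.2.2 (p.1 - p.2.1)) :=
    (measurable_phi.comp (by fun_prop : Measurable fun p : ℝ × ℝ × ℝ =>
      (p.2.2, p.1 - p.2.1))).ennreal_ofReal
  ext S hS
  rw [Measure.map_apply measurable_triple hS, Measure.prod_apply_symm (measurable_triple hS),
    tripleLaw, withDensity_apply _ hS, ← lintegral_indicator hS,
    lintegral_prod_symm' _ (hm.indicator hS), lintegral_prod_symm' _
      (hm.indicator hS).lintegral_prod_left']
  refine lintegral_congr_ae ?_
  filter_upwards [hσ] with σ hσ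
  rw [noiseLaw, Measure.prod_apply_symm (measurable_prodMk_right (measurable_triple hS))]
  refine lintegral_congr fun m => ?_
  have hslice : MeasurableSet {x : ℝ | (x, m, σ) ∈ S} :=
    (by fun_prop : Measurable fun x : ℝ => (x, m, σ)) hS
  exact (lintegral_indicator hslice _).trans (setLIntegral_phi hσ m hslice)

lemma isProbabilityMeasure_tripleLaw (hσ : ∀ᵐ σ ∂Gσ, 0 < σ) :
    IsProbabilityMeasure (tripleLaw G Gσ) := by
  rw [tripleLaw_eq_map hσ]
  exact Measure.isProbabilityMeasure_map measurable_triple.aemeasurable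

lemma isProbabilityMeasure_sampleLaw (n : ℕ) (hσ : ∀ᵐ σ ∂Gσ, 0 < σ) :
    IsProbabilityMeasure (sampleLaw n G Gσ) := by
  have := isProbabilityMeasure_tripleLaw (G := G) hσ
  unfold sampleLaw; infer_instance

lemma tripleLaw_apply_le (hσ : ∀ᵐ σ ∂Gσ, 0 < σ) {S : Set (ℝ × ℝ)} (hS : MeasurableSet S)
    {c : ENNReal} (hc : ∀ᵐ σ ∂Gσ, obsLaw G σ {x | (x, σ) ∈ S} ≤ c) :
    tripleLaw G Gσ {t | (t.1, t.2.2) ∈ S} ≤ c := by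
  have hS' : MeasurableSet {t : ℝ × ℝ × ℝ | (t.1, t.2.2) ∈ S} :=
    (by fun_prop : Measurable fun t : ℝ × ℝ × ℝ => (t.1, t.2.2)) hS
  rw [tripleLaw_eq_map hσ, Measure.map_apply measurable_triple hS',
    Measure.prod_apply_symm (measurable_triple hS')]
  calc _ ≤ ∫⁻ _, c ∂Gσ := lintegral_mono_ae ?_
    _ = c := by simp
  filter_upwards [hc] with σ hc
  have hslice : MeasurableSet {x : ℝ | (x, σ) ∈ S} := measurable_prodMk_right hS
  rwa [obsLaw, Measure.map_apply (measurable_triple_fst σ) hslice] at hc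

lemma measurePreserving_sampleLaw (n : ℕ) (hσ : ∀ᵐ σ ∂Gσ, 0 < σ) :
    MeasurePreserving (fun (q : (Fin n → ℝ × ℝ) × (Fin n → ℝ)) j => triple (q.1 j) (q.2 j))
      ((Measure.pi fun _ => noiseLaw G).prod (Measure.pi fun _ => Gσ)) (sampleLaw n G Gσ) := by
  have htriple : MeasurePreserving (fun q : (ℝ × ℝ) × ℝ => triple q.1 q.2)
      ((noiseLaw G).prod Gσ) (tripleLaw G Gσ) := ⟨measurable_triple, (tripleLaw_eq_map hσ).symm⟩
  have := isProbabilityMeasure_tripleLaw (G := G) hσ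
  exact (measurePreserving_pi _ _ fun _ => htriple).comp
    (measurePreserving_arrowProdEquivProdArrow (ℝ × ℝ) ℝ (Fin n)
      (fun _ => noiseLaw G) (fun _ => Gσ)).symm

lemma integral_sampleLaw_le {n : ℕ} (hσ : ∀ᵐ σ ∂Gσ, 0 < σ) {F : (Fin n → ℝ) → (Fin n → ℝ) → ℝ}
    (hF : Measurable fun q : (Fin n → ℝ) × (Fin n → ℝ) => F q.1 q.2)
    (hint : Integrable (fun D => F (fun j => (D j).1) fun j => (D j).2.2) (sampleLaw n G Gσ))
    {c : ℝ} (hc : ∀ᵐ s ∂(Measure.pi fun _ : Fin n => Gσ),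
      ∫ x, F x s ∂(Measure.pi fun j => obsLaw G (s j)) ≤ c) :
    ∫ D, F (fun j => (D j).1) (fun j => (D j).2.2) ∂sampleLaw n G Gσ ≤ c := by
  have hmp := measurePreserving_sampleLaw (G := G) n hσ
  have hcond (s : Fin n → ℝ) : ∫ ω, F (fun j => (triple (ω j) (s j)).1) s
      ∂(Measure.pi fun _ => noiseLaw G) = ∫ x, F x s ∂(Measure.pi fun j => obsLaw G (s j)) := by
    have hobs : MeasurePreserving (fun (ω : Fin n → ℝ × ℝ) j => (triple (ω j) (s j)).1)
        (Measure.pi fun _ => noiseLaw G) (Measure.pi fun j => obsLaw G (s j)) :=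
      measurePreserving_pi _ _ fun j => ⟨measurable_triple_fst (s j), rfl⟩
    rw [← hobs.map_eq, integral_map hobs.aemeasurable]
    exact (hF.comp measurable_prodMk_right).aestronglyMeasurable
  have hint' : Integrable (fun q : (Fin n → ℝ × ℝ) × (Fin n → ℝ) =>
      F (fun j => (triple (q.1 j) (q.2 j)).1) q.2)
      ((Measure.pi fun _ => noiseLaw G).prod (Measure.pi fun _ => Gσ)) :=
    (hmp.integrable_comp hint.aestronglyMeasurable).2 hint
  calc ∫ D, F (fun j => (D j).1) (fun j => (D j).2.2) ∂sampleLaw n G Gσ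
      = ∫ q, F (fun j => (triple (q.1 j) (q.2 j)).1) q.2
          ∂((Measure.pi fun _ => noiseLaw G).prod (Measure.pi fun _ => Gσ)) := by
        rw [← hmp.map_eq, integral_map hmp.aemeasurable (by rw [hmp.map_eq]; exact hint.1)]
        rfl
    _ = ∫ s, ∫ ω, F (fun j => (triple (ω j) (s j)).1) s
          ∂(Measure.pi fun _ => noiseLaw G) ∂(Measure.pi fun _ => Gσ) :=
        integral_prod_symm _ hint'
    _ ≤ ∫ _, c ∂(Measure.pi fun _ : Fin n => Gσ) := by
        refine integral_mono_ae hint'.integral_prod_right (integrable_const c) ?_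
        filter_upwards [hc] with s hc
        exact (hcond s).trans_le hc
    _ = c := by simp

lemma integral_obsLaw {f : ℝ → ℝ} (hf : Measurable f) {B : ℝ} (hB : ∀ x, |f x| ≤ B) (σ : ℝ) :
    ∫ x, f x ∂obsLaw G σ = ∫ m, ∫ z, f (m + σ * z) ∂(gaussianReal 0 1) ∂G := by
  rw [obsLaw, integral_map (measurable_triple_fst σ).aemeasurable hf.aestronglyMeasurable]
  exact integral_prod_symm _ <| Integrable.of_bound
    (hf.comp (measurable_triple_fst σ)).aestronglyMeasurable B (ae_of_all _ fun _ => hB _)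

lemma IsGaussianKernel.integral_obsLaw {r : ℕ} {A : ℝ} {k : ℝ → ℝ → ℝ}
    (hk : IsGaussianKernel r A k) {h σ : ℝ} (hh : 0 < h) (hσ : 0 < σ) (t : ℝ) :
    ∫ x, k h (t - x) ∂obsLaw G σ = mixture k G (√(σ ^ 2 + h ^ 2)) t := by
  rw [NEST.integral_obsLaw (f := fun x => k h (t - x))
    ((measurable_comp_kernel hk.measurable h).comp (by fun_prop)) (fun _ => hk.abs_le hh _)]
  exact integral_congr_ae (ae_of_all _ fun m => by simp only [← sub_sub, hk.conv hh hσ])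

lemma obsLaw_eq_withDensity {σ : ℝ} (hσ : 0 < σ) :
    obsLaw G σ = volume.withDensity fun x => ENNReal.ofReal (marginal G σ x) := by
  have hm : Measurable fun p : ℝ × ℝ => ENNReal.ofReal (phi σ (p.2 - p.1)) :=
    ((measurable_comp_kernel measurable_phi σ).comp (by fun_prop)).ennreal_ofReal
  ext S hS
  rw [withDensity_apply _ hS, obsLaw, Measure.map_apply (measurable_triple_fst σ) hS, noiseLaw,
    Measure.prod_apply_symm (measurable_triple_fst σ hS)]
  calc _ = ∫⁻ m, ∫⁻ x in S, ENNReal.ofReal (phi σ (x - m)) ∂volume ∂G :=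
        lintegral_congr fun m => (setLIntegral_phi hσ m hS).symm
    _ = ∫⁻ x in S, ∫⁻ m, ENNReal.ofReal (phi σ (x - m)) ∂G :=
        lintegral_lintegral_swap hm.aemeasurable
    _ = _ := lintegral_congr fun x =>
        (ofReal_integral_eq_lintegral_ofReal (isGaussianKernel_phi.integrable_sub hσ x)
          (ae_of_all _ fun m => (phi_pos hσ _).le)).symm

lemma integral_sq_gaussianReal : ∫ z, z ^ 2 ∂(gaussianReal 0 1) = 1 := by
  have h := variance_id_gaussianReal (μ := 0) (v := 1)
  rw [variance_eq_integral measurable_id.aemeasurable] at h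
  simpa using h

lemma obsLaw_abs_ge_le {C σ R : ℝ} (hC : ∀ᵐ m ∂G, |m| ≤ C) (hR : 0 < R) :
    obsLaw G σ {x | R ≤ |x|} ≤ ENNReal.ofReal ((2 * C ^ 2 + 2 * σ ^ 2) / R ^ 2) := by
  let g : ℝ × ℝ → ℝ := fun ω => 2 * C ^ 2 + 2 * σ ^ 2 * ω.1 ^ 2
  have hsq : Integrable (fun z : ℝ => z ^ 2) (gaussianReal 0 1) :=
    (memLp_id_gaussianReal 2).integrable_sq
  have hgi : Integrable g (noiseLaw G) :=
    (integrable_const _).add ((hsq.comp_fst G).const_mul _)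
  have hgv : ∫ ω, g ω ∂noiseLaw G = 2 * C ^ 2 + 2 * σ ^ 2 := by
    have h := integral_fun_fst (μ := gaussianReal 0 1) (ν := G) fun z : ℝ => z ^ 2
    rw [integral_sq_gaussianReal] at h
    change ∫ ω : ℝ × ℝ, 2 * C ^ 2 + 2 * σ ^ 2 * ω.1 ^ 2 ∂(gaussianReal 0 1).prod G = _
    rw [integral_add (integrable_const _) ((hsq.comp_fst G).const_mul _), integral_const,
      integral_const_mul, h]
    simp
  have hcheb := mul_meas_ge_le_integral_of_nonneg
    (ae_of_all (noiseLaw G) fun ω => (by positivity : 0 ≤ g ω)) hgi (R ^ 2)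
  rw [hgv] at hcheb
  rw [obsLaw, Measure.map_apply (measurable_triple_fst σ) (by measurability)]
  calc _ ≤ noiseLaw G {ω | R ^ 2 ≤ g ω} := by
        refine measure_mono_ae ?_
        filter_upwards [Measure.quasiMeasurePreserving_snd.ae hC] with ω hω hRω
        have hsum : (ω.2 + σ * ω.1) ^ 2 ≤ 2 * (ω.2 ^ 2 + (σ * ω.1) ^ 2) := add_sq_le
        have hmean : ω.2 ^ 2 ≤ C ^ 2 := sq_le_sq' (abs_le.1 hω).1 (abs_le.1 hω).2
        have hR2 : R ^ 2 ≤ (ω.2 + σ * ω.1) ^ 2 := by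
          rw [← sq_abs (ω.2 + _)]; exact pow_le_pow_left₀ hR.le hRω 2
        change R ^ 2 ≤ 2 * C ^ 2 + 2 * σ ^ 2 * ω.1 ^ 2
        linarith [mul_pow σ ω.1 2]
    _ ≤ _ := by
        rw [← ofReal_measureReal]
        refine ENNReal.ofReal_le_ofReal ?_
        rwa [le_div_iff₀' (by positivity)]

lemma obsLaw_marginal_lt_le {C σ τ R : ℝ} (hC : ∀ᵐ m ∂G, |m| ≤ C) (hσ : 0 < σ) (hR : 0 < R)
    (hτ : 0 ≤ τ) :
    obsLaw G σ {x | marginal G σ x < τ}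
      ≤ ENNReal.ofReal (τ * (2 * R) + (2 * C ^ 2 + 2 * σ ^ 2) / R ^ 2) := by
  have hmeas : MeasurableSet ({x | marginal G σ x < τ} ∩ Set.Icc (-R) R) :=
    (measurableSet_lt ((measurable_mixture measurable_phi).comp measurable_prodMk_left)
      measurable_const).inter measurableSet_Icc
  have hlow : obsLaw G σ ({x | marginal G σ x < τ} ∩ Set.Icc (-R) R)
      ≤ ENNReal.ofReal (τ * (2 * R)) := by
    rw [obsLaw_eq_withDensity hσ, withDensity_apply _ hmeas]
    calc _ ≤ ∫⁻ _ in {x | marginal G σ x < τ} ∩ Set.Icc (-R) R, ENNReal.ofReal τ :=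
          setLIntegral_mono measurable_const fun x hx => ENNReal.ofReal_le_ofReal hx.1.le
      _ ≤ ENNReal.ofReal τ * volume (Set.Icc (-R) R) := by
          rw [setLIntegral_const]
          exact mul_le_mul_right (measure_mono Set.inter_subset_right) _
      _ = _ := by rw [Real.volume_Icc, ← ENNReal.ofReal_mul hτ]; ring_nf
  calc _ ≤ obsLaw G σ (({x | marginal G σ x < τ} ∩ Set.Icc (-R) R) ∪ {x | R ≤ |x|}) := by
        refine measure_mono fun x hx => ?_
        rcases le_total R |x| with h | h
        exacts [.inr h, .inl ⟨hx, abs_le.1 h⟩]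
    _ ≤ _ := measure_union_le _ _
    _ ≤ _ := add_le_add hlow (obsLaw_abs_ge_le hC hR)
    _ = _ := (ENNReal.ofReal_add (by positivity) (by positivity)).symm

end Laws

/-! ### Independent observations -/

section Independent

variable {ι : Type*} [Fintype ι] {α : ι → Type*} {mα : ∀ i, MeasurableSpace (α i)}
  (μ : ∀ i, Measure (α i)) [∀ i, IsProbabilityMeasure (μ i)]

lemma measurePreserving_update [DecidableEq ι] (i : ι) :
    MeasurePreserving (fun p : α i × (∀ j, α j) => Function.update p.2 i p.1)
      ((μ i).prod (Measure.pi μ)) (Measure.pi μ) := by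
  have hm : Measurable fun p : α i × (∀ j, α j) => Function.update p.2 i p.1 := by
    fun_prop
  refine ⟨hm, (Measure.pi_eq fun S hS => ?_).symm⟩
  have hpre : (fun p : α i × (∀ j, α j) => Function.update p.2 i p.1) ⁻¹' Set.univ.pi S
      = S i ×ˢ Set.univ.pi (Function.update S i Set.univ) := by
    ext p
    simp only [Set.mem_preimage, Set.mem_univ_pi, Set.mem_prod]
    rw [Function.forall_update_iff p.2 fun j y => y ∈ S j,
      Function.forall_update_iff S fun j T => p.2 j ∈ T]
    simp
  rw [Measure.map_apply hm (MeasurableSet.univ_pi hS), hpre, Measure.prod_prod, Measure.pi_pi,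
    ← Finset.mul_prod_erase _ _ (Finset.mem_univ i),
    ← Finset.mul_prod_erase Finset.univ (fun j => μ j (S j)) (Finset.mem_univ i),
    Function.update_self, measure_univ, one_mul]
  congr 1
  exact Finset.prod_congr rfl fun j hj => by rw [Function.update_of_ne (Finset.ne_of_mem_erase hj)]

lemma integral_abs_sub_integral_le_sqrt_variance {Ω : Type*} [MeasurableSpace Ω] {P : Measure Ω}
    [IsProbabilityMeasure P] {X : Ω → ℝ} (hX : MemLp X 2 P) :
    ∫ ω, |X ω - ∫ ω', X ω' ∂P| ∂P ≤ √Var[X; P] := by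
  have hdev : MemLp (fun ω => |X ω - ∫ ω', X ω' ∂P|) 2 P := (hX.sub (memLp_const _)).norm
  have h := variance_nonneg (fun ω => |X ω - ∫ ω', X ω' ∂P|) P
  rw [variance_eq_sub hdev] at h
  rw [variance_eq_integral hX.aemeasurable]
  refine Real.le_sqrt_of_sq_le ?_
  simpa only [Pi.pow_apply, sq_abs, sub_nonneg] using h

variable {μ}

lemma integral_abs_sum_sub_le {Y : ∀ i, α i → ℝ} (hY : ∀ i, MemLp (Y i) 2 (μ i)) {v : ℝ}
    (hv : ∀ i, ∫ y, Y i y ^ 2 ∂μ i ≤ v) (w : ι → ℝ) :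
    ∫ x, |∑ i, w i * Y i (x i) - ∑ i, w i * ∫ y, Y i y ∂μ i| ∂(Measure.pi μ)
      ≤ √(v * ∑ i, w i ^ 2) := by
  have hX (i) : MemLp (fun y => w i * Y i y) 2 (μ i) := (hY i).const_mul _
  have hXi (i) : MemLp (fun x : ∀ j, α j => w i * Y i (x i)) 2 (Measure.pi μ) :=
    (hX i).comp_measurePreserving (measurePreserving_eval μ i)
  have hmean : ∫ x, ∑ i, w i * Y i (x i) ∂(Measure.pi μ) = ∑ i, w i * ∫ y, Y i y ∂μ i := by
    rw [integral_finsetSum _ fun i _ => (hXi i).integrable one_le_two]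
    refine Finset.sum_congr rfl fun i _ => ?_
    rw [integral_const_mul, integral_comp_eval (hY i).aestronglyMeasurable]
  have hvar : Var[fun x => ∑ i, w i * Y i (x i); Measure.pi μ] ≤ v * ∑ i, w i ^ 2 := by
    have hsum := variance_sum_pi hX
    rw [show (∑ i, fun x : ∀ j, α j => w i * Y i (x i)) = fun x => ∑ i, w i * Y i (x i) by
      ext x; simp] at hsum
    rw [hsum, Finset.mul_sum]
    refine Finset.sum_le_sum fun i _ => ?_
    rw [variance_const_mul, mul_comm v]
    exact mul_le_mul_of_nonneg_left
      ((variance_le_expectation_sq (hY i).aestronglyMeasurable).trans (hv i)) (sq_nonneg _)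
  rw [← hmean]
  exact (integral_abs_sub_integral_le_sqrt_variance (memLp_finsetSum _ fun i _ => hXi i)).trans
    (Real.sqrt_le_sqrt hvar)

end Independent

/-! ### The error of the kernel estimates -/

/-- The weighted kernel estimate at `t` of `mixture k G σ`, from the observations `(x j, s j)`; for
`k = phi` this is `kde`, and for `k = dphi` its derivative. -/
def kernelEst {n : ℕ} (k : ℝ → ℝ → ℝ) (hx hs : ℝ) (x s : Fin n → ℝ) (σ t : ℝ) : ℝ :=
  ∑ j, weight hs s σ j * k (hx * s j) (t - x j)

/-- The absolute error of the kernel estimate at the `i`-th observation, which itself enters the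
estimate. -/
def kernelError {n : ℕ} (k : ℝ → ℝ → ℝ) (G : Measure ℝ) (hx hs : ℝ) (x s : Fin n → ℝ)
    (i : Fin n) : ℝ :=
  |kernelEst k hx hs x s (s i) (x i) - mixture k G (s i) (x i)|

/-- Bound for the mean absolute error of a kernel estimate at an observation of weight `W` in its
own estimate: standard deviation, effect of that observation, and bias. -/
def kernelErrorBound (r : ℕ) (A σl σu hx hs : ℝ) (n : ℕ) (W : ℝ) : ℝ :=
  √(A / ((hx * σl) ^ (2 * r + 1) * σl) * W) + 2 * A / (hx * σl) ^ (r + 1) * W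
    + A / σl ^ (r + 2) * (hx * σu + hs * (Real.log n + 1))

lemma deriv_kde {n : ℕ} (hx hs : ℝ) (x s : Fin n → ℝ) (σ t : ℝ) :
    deriv (kde hx hs x s σ) t = kernelEst dphi hx hs x s σ t :=
  (HasDerivAt.fun_sum fun j _ =>
    ((hasDerivAt_phi _ _).comp_sub_const t (x j)).const_mul (weight hs s σ j)).deriv

lemma measurable_kernelEst {n : ℕ} {k : ℝ → ℝ → ℝ} (hk : Measurable fun p : ℝ × ℝ => k p.1 p.2)
    (hx hs : ℝ) {β : Type*} [MeasurableSpace β] {x s : β → Fin n → ℝ} {σ t : β → ℝ}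
    (hxm : Measurable x) (hsm : Measurable s) (hσ : Measurable σ) (ht : Measurable t) :
    Measurable fun b => kernelEst k hx hs (x b) (s b) (σ b) (t b) := by
  have hphi (j : Fin n) : Measurable fun b => phi hs (σ b - s b j) :=
    (measurable_comp_kernel measurable_phi hs).comp (by fun_prop)
  refine Finset.measurable_sum _ fun j _ => Measurable.mul ?_ ?_
  · exact (hphi j).div (Finset.measurable_sum _ fun j _ => hphi j)
  · exact hk.comp (by fun_prop : Measurable fun b => (hx * s b j, t b - x b j))

lemma measurable_kernelError {n : ℕ} {k : ℝ → ℝ → ℝ} {G : Measure ℝ} [SFinite G]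
    (hk : Measurable fun p : ℝ × ℝ => k p.1 p.2) (hx hs : ℝ) (i : Fin n) {β : Type*}
    [MeasurableSpace β] {x s : β → Fin n → ℝ} (hxm : Measurable x) (hsm : Measurable s) :
    Measurable fun b => kernelError k G hx hs (x b) (s b) i :=
  ((measurable_kernelEst hk hx hs hxm hsm (by fun_prop) (by fun_prop)).sub
    ((measurable_mixture hk).comp (by fun_prop : Measurable fun b => (s b i, x b i)))).norm

lemma sqrt_sq_add_sq_mem_Icc {s h : ℝ} (hs : 0 ≤ s) (hh : 0 ≤ h) :
    √(s ^ 2 + h ^ 2) ∈ Set.Icc s (s + h) :=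
  ⟨Real.le_sqrt_of_sq_le (by nlinarith), (Real.sqrt_le_left (by positivity)).2 (by nlinarith)⟩

namespace IsGaussianKernel

variable {r n : ℕ} {A σl σu hx hs : ℝ} {k : ℝ → ℝ → ℝ} {G : Measure ℝ} {s : Fin n → ℝ}

lemma abs_kernelEst_le (hk : IsGaussianKernel r A k) (hσl : 0 < σl) (hs_mem : ∀ j, σl ≤ s j)
    (hx0 : 0 < hx) (hs0 : 0 < hs) (x : Fin n → ℝ) (i : Fin n) (t : ℝ) :
    |kernelEst k hx hs x s (s i) t| ≤ A / (hx * σl) ^ (r + 1) := by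
  have hA := hk.const_nonneg
  refine (abs_sum_weight_mul_le hs0 s (s i) (b := fun _ => A / (hx * σl) ^ (r + 1))
    fun j => ?_).trans_eq (by rw [← Finset.sum_mul, sum_weight s i hs0, one_mul])
  refine (hk.abs_le (mul_pos hx0 (hσl.trans_le (hs_mem j))) _).trans ?_
  gcongr
  exact hs_mem j

lemma integrable_abs_kernelEst_sub (hk : IsGaussianKernel r A k) (hσl : 0 < σl)
    (hs_mem : ∀ j, σl ≤ s j) (hx0 : 0 < hx) (hs0 : 0 < hs) (P : Measure (Fin n → ℝ))
    [IsFiniteMeasure P] (i : Fin n) (t c : ℝ) :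
    Integrable (fun x => |kernelEst k hx hs x s (s i) t - c|) P :=
  ((Integrable.of_bound (measurable_kernelEst hk.measurable hx hs measurable_id measurable_const
    measurable_const measurable_const).aestronglyMeasurable _ (ae_of_all _ fun x =>
      hk.abs_kernelEst_le hσl hs_mem hx0 hs0 x i t)).sub (integrable_const c)).abs

lemma abs_kernelEst_update_sub_le (hk : IsGaussianKernel r A k) (hσl : 0 < σl)
    (hs_mem : ∀ j, σl ≤ s j) (hx0 : 0 < hx) (hs0 : 0 < hs) (x : Fin n → ℝ) (i : Fin n) (y t : ℝ) :
    |kernelEst k hx hs (Function.update x i y) s (s i) t - kernelEst k hx hs x s (s i) t|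
      ≤ 2 * A / (hx * σl) ^ (r + 1) * weight hs s (s i) i := by
  have hA := hk.const_nonneg
  have hle (z : ℝ) : |k (hx * s i) z| ≤ A / (hx * σl) ^ (r + 1) := by
    refine (hk.abs_le (mul_pos hx0 (hσl.trans_le (hs_mem i))) z).trans ?_
    gcongr
    exact hs_mem i
  have hdiff : kernelEst k hx hs (Function.update x i y) s (s i) t - kernelEst k hx hs x s (s i) t
      = weight hs s (s i) i * (k (hx * s i) (t - y) - k (hx * s i) (t - x i)) := by
    rw [kernelEst, kernelEst, ← Finset.sum_sub_distrib, Finset.sum_eq_single i]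
    · rw [Function.update_self, mul_sub]
    · intro j _ hj; rw [Function.update_of_ne hj, sub_self]
    · simp
  rw [hdiff, abs_mul, abs_of_nonneg (weight_nonneg hs0 s _ i), mul_comm, mul_div_assoc]
  gcongr
  · exact weight_nonneg hs0 s _ i
  · linarith [abs_sub (k (hx * s i) (t - y)) (k (hx * s i) (t - x i)), hle (t - y), hle (t - x i)]

variable [IsProbabilityMeasure G]

lemma integral_sq_obsLaw_le (hk : IsGaussianKernel r A k) {h σ : ℝ} (hh : 0 < h) (hσ : 0 < σ)
    (t : ℝ) : ∫ x, k h (t - x) ^ 2 ∂obsLaw G σ ≤ A / (h ^ (2 * r + 1) * σ) := by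
  have hA := hk.const_nonneg
  have hroot := (sqrt_sq_add_sq_mem_Icc hσ.le hh.le).1
  have hmeas {l : ℝ → ℝ → ℝ} (hl : Measurable fun p : ℝ × ℝ => l p.1 p.2) :
      Measurable fun x => l h (t - x) := (measurable_comp_kernel hl h).comp (by fun_prop)
  have hint : Integrable (fun x => phi h (t - x)) (obsLaw G σ) :=
    .of_bound (hmeas measurable_phi).aestronglyMeasurable (1 / |h|)
      (ae_of_all _ fun x => abs_phi_le h _)
  calc ∫ x, k h (t - x) ^ 2 ∂obsLaw G σ
      ≤ ∫ x, A / h ^ (2 * r + 1) * phi h (t - x) ∂obsLaw G σ :=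
        integral_mono_of_nonneg (ae_of_all _ fun x => sq_nonneg _) (hint.const_mul _)
          (ae_of_all _ fun x => hk.sq_le hh _)
    _ = A / h ^ (2 * r + 1) * mixture phi G (√(σ ^ 2 + h ^ 2)) t := by
        rw [integral_const_mul, isGaussianKernel_phi.integral_obsLaw hh hσ]
    _ ≤ A / h ^ (2 * r + 1) * (1 / σ) := by
        gcongr
        refine (le_abs_self _).trans
          ((isGaussianKernel_phi.abs_mixture_le (hσ.trans_le hroot) t).trans ?_)
        rw [zero_add, pow_one]
        gcongr
    _ = _ := by rw [div_mul_div_comm, mul_one]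

lemma abs_sum_weight_mul_mixture_sub_le (hk : IsGaussianKernel r A k) (hσl : 0 < σl)
    (hs_mem : ∀ j, σl ≤ s j ∧ s j ≤ σu) (hx0 : 0 < hx) (hs0 : 0 < hs) (i : Fin n) (t : ℝ) :
    |∑ j, weight hs s (s i) j * mixture k G (√(s j ^ 2 + (hx * s j) ^ 2)) t - mixture k G (s i) t|
      ≤ A / σl ^ (r + 2) * (hx * σu + hs * (Real.log n + 1)) := by
  have hA := hk.const_nonneg
  have hterm (j : Fin n) : |mixture k G (√(s j ^ 2 + (hx * s j) ^ 2)) t - mixture k G (s i) t|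
      ≤ A / σl ^ (r + 2) * (hx * σu + |s i - s j|) := by
    have hsj := hσl.trans_le (hs_mem j).1
    have hroot := sqrt_sq_add_sq_mem_Icc hsj.le (mul_pos hx0 hsj).le
    refine (hk.abs_mixture_sub_le hσl ((hs_mem j).1.trans hroot.1) (hs_mem i).1 t).trans ?_
    gcongr
    calc _ ≤ |√(s j ^ 2 + (hx * s j) ^ 2) - s j| + |s j - s i| := abs_sub_le _ _ _
      _ ≤ _ := by
        rw [abs_of_nonneg (sub_nonneg.2 hroot.1), abs_sub_comm (s j)]
        have := mul_le_mul_of_nonneg_left (hs_mem j).2 hx0.le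
        linarith [hroot.2]
  calc _ = |∑ j, weight hs s (s i) j *
        (mixture k G (√(s j ^ 2 + (hx * s j) ^ 2)) t - mixture k G (s i) t)| := by
        simp_rw [mul_sub]
        rw [Finset.sum_sub_distrib, ← Finset.sum_mul, sum_weight s i hs0, one_mul]
    _ ≤ ∑ j, weight hs s (s i) j * (A / σl ^ (r + 2) * (hx * σu + |s i - s j|)) :=
        abs_sum_weight_mul_le hs0 s _ hterm
    _ = A / σl ^ (r + 2) * (hx * σu + ∑ j, weight hs s (s i) j * |s i - s j|) := by
        simp_rw [mul_left_comm _ (A / _), ← Finset.mul_sum, mul_add, Finset.sum_add_distrib,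
          ← Finset.sum_mul, sum_weight s i hs0, one_mul, mul_add]
    _ ≤ _ := by gcongr; exact sum_weight_mul_abs_le s i hs0

lemma integral_abs_kernelEst_sub_le (hk : IsGaussianKernel r A k) (hσl : 0 < σl)
    (hs_mem : ∀ j, σl ≤ s j ∧ s j ≤ σu) (hx0 : 0 < hx) (hs0 : 0 < hs) (i : Fin n) (t : ℝ) :
    ∫ x, |kernelEst k hx hs x s (s i) t - mixture k G (s i) t| ∂(Measure.pi fun j => obsLaw G (s j))
      ≤ √(A / ((hx * σl) ^ (2 * r + 1) * σl) * weight hs s (s i) i)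
        + A / σl ^ (r + 2) * (hx * σu + hs * (Real.log n + 1)) := by
  have hA := hk.const_nonneg
  have hh (j : Fin n) : 0 < hx * s j := mul_pos hx0 (hσl.trans_le (hs_mem j).1)
  have hY (j : Fin n) : MemLp (fun y => k (hx * s j) (t - y)) 2 (obsLaw G (s j)) :=
    .of_bound ((measurable_comp_kernel hk.measurable _).comp (by fun_prop)).aestronglyMeasurable
      (A / (hx * s j) ^ (r + 1)) (ae_of_all _ fun _ => hk.abs_le (hh j) _)
  have hv (j : Fin n) : ∫ y, k (hx * s j) (t - y) ^ 2 ∂obsLaw G (s j)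
      ≤ A / ((hx * σl) ^ (2 * r + 1) * σl) := by
    have hsj := hσl.trans_le (hs_mem j).1
    refine (hk.integral_sq_obsLaw_le (hh j) hsj t).trans ?_
    gcongr
    exacts [(hs_mem j).1, (hs_mem j).1]
  have hdev := (integral_abs_sum_sub_le hY hv (weight hs s (s i))).trans (Real.sqrt_le_sqrt
    (mul_le_mul_of_nonneg_left (sum_weight_sq_le s i hs0) (by positivity)))
  simp only [hk.integral_obsLaw (hh _) (hσl.trans_le (hs_mem _).1)] at hdev
  set e := ∑ j, weight hs s (s i) j * mixture k G (√(s j ^ 2 + (hx * s j) ^ 2)) t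
  have hint := hk.integrable_abs_kernelEst_sub hσl (fun j => (hs_mem j).1) hx0 hs0
    (Measure.pi fun j => obsLaw G (s j)) i t
  calc _ ≤ ∫ x, |kernelEst k hx hs x s (s i) t - e| + |e - mixture k G (s i) t|
        ∂(Measure.pi fun j => obsLaw G (s j)) :=
        integral_mono (hint _) ((hint _).add (integrable_const _)) fun x => abs_sub_le _ _ _
    _ = ∫ x, |kernelEst k hx hs x s (s i) t - e| ∂(Measure.pi fun j => obsLaw G (s j))
        + |e - mixture k G (s i) t| := by
        rw [integral_add (hint _) (integrable_const _)]; simp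
    _ ≤ _ := add_le_add hdev (hk.abs_sum_weight_mul_mixture_sub_le hσl hs_mem hx0 hs0 i t)

lemma kernelError_le (hk : IsGaussianKernel r A k) (hσl : 0 < σl) (hs_mem : ∀ j, σl ≤ s j)
    (hx0 : 0 < hx) (hs0 : 0 < hs) (x : Fin n → ℝ) (i : Fin n) :
    kernelError k G hx hs x s i ≤ A / (hx * σl) ^ (r + 1) + A / σl ^ (r + 1) := by
  have hA := hk.const_nonneg
  refine (abs_sub _ _).trans (add_le_add (hk.abs_kernelEst_le hσl hs_mem hx0 hs0 x i _) ?_)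
  refine (hk.abs_mixture_le (hσl.trans_le (hs_mem i)) _).trans ?_
  gcongr
  exact hs_mem i

-- Resampling the `i`-th observation makes the point of evaluation independent of the estimate.
lemma integral_kernelError_le (hk : IsGaussianKernel r A k) (hσl : 0 < σl)
    (hs_mem : ∀ j, σl ≤ s j ∧ s j ≤ σu) (hx0 : 0 < hx) (hs0 : 0 < hs) (i : Fin n) :
    ∫ x, kernelError k G hx hs x s i ∂(Measure.pi fun j => obsLaw G (s j))
      ≤ kernelErrorBound r A σl σu hx hs n (weight hs s (s i) i) := by
  have hmp := measurePreserving_update (fun j => obsLaw G (s j)) i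
  have hmeas : Measurable fun x => kernelError k G hx hs x s i :=
    measurable_kernelError hk.measurable hx hs i measurable_id measurable_const
  have hint : Integrable (fun p : ℝ × (Fin n → ℝ) =>
      kernelError k G hx hs (Function.update p.2 i p.1) s i)
      ((obsLaw G (s i)).prod (Measure.pi fun j => obsLaw G (s j))) :=
    .of_bound (hmeas.comp hmp.measurable).aestronglyMeasurable _ (ae_of_all _ fun p =>
      (abs_abs _).trans_le (hk.kernelError_le hσl (fun j => (hs_mem j).1) hx0 hs0 _ i))
  have hcond (y : ℝ) : ∫ x, kernelError k G hx hs (Function.update x i y) s i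
        ∂(Measure.pi fun j => obsLaw G (s j))
      ≤ kernelErrorBound r A σl σu hx hs n (weight hs s (s i) i) := by
    have hfix := hk.integrable_abs_kernelEst_sub hσl (fun j => (hs_mem j).1) hx0 hs0
      (Measure.pi fun j => obsLaw G (s j)) i y (mixture k G (s i) y)
    calc _ ≤ ∫ x, 2 * A / (hx * σl) ^ (r + 1) * weight hs s (s i) i
          + |kernelEst k hx hs x s (s i) y - mixture k G (s i) y|
          ∂(Measure.pi fun j => obsLaw G (s j)) := by
          refine integral_mono_of_nonneg (ae_of_all _ fun x => abs_nonneg _)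
            ((integrable_const _).add hfix) (ae_of_all _ fun x => ?_)
          simp only [kernelError, Function.update_self]
          refine (abs_sub_le _ (kernelEst k hx hs x s (s i) y) _).trans ?_
          gcongr
          exact hk.abs_kernelEst_update_sub_le hσl (fun j => (hs_mem j).1) hx0 hs0 x i y y
      _ = 2 * A / (hx * σl) ^ (r + 1) * weight hs s (s i) i
          + ∫ x, |kernelEst k hx hs x s (s i) y - mixture k G (s i) y|
            ∂(Measure.pi fun j => obsLaw G (s j)) := by
          rw [integral_add (integrable_const _) hfix]; simp
      _ ≤ _ := by
          rw [kernelErrorBound]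
          linarith [hk.integral_abs_kernelEst_sub_le (G := G) hσl hs_mem hx0 hs0 i y]
  rw [← hmp.map_eq, integral_map hmp.aemeasurable hmeas.aestronglyMeasurable,
    integral_prod _ hint]
  calc _ ≤ ∫ _, kernelErrorBound r A σl σu hx hs n (weight hs s (s i) i) ∂obsLaw G (s i) :=
        integral_mono hint.integral_prod_left (integrable_const _) hcond
    _ = _ := by simp

end IsGaussianKernel

lemma kernelErrorBound_average_le {n : ℕ} (hn : 0 < n) (r : ℕ) {A σl σu hx hs b : ℝ} (hA : 0 ≤ A)
    (hσl : 0 < σl) (hx0 : 0 < hx) {W : Fin n → ℝ} (hW : ∀ i, 0 ≤ W i)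
    (hb : (n : ℝ)⁻¹ * ∑ i, W i ≤ b) :
    (n : ℝ)⁻¹ * ∑ i, kernelErrorBound r A σl σu hx hs n (W i)
      ≤ kernelErrorBound r A σl σu hx hs n b := by
  have hnn : (n : ℝ) ≠ 0 := by positivity
  set c := A / ((hx * σl) ^ (2 * r + 1) * σl)
  have hjensen : (n : ℝ)⁻¹ * ∑ i, √(c * W i) ≤ √(c * b) := by
    calc (n : ℝ)⁻¹ * ∑ i, √(c * W i) = ∑ i, (n : ℝ)⁻¹ * √(c * W i) := Finset.mul_sum _ _ _
      _ ≤ √(∑ i, (n : ℝ)⁻¹ * (c * W i)) :=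
          Real.strictConcaveOn_sqrt.concaveOn.le_map_sum (fun _ _ => by positivity)
            (by simp [hnn]) fun i _ => mul_nonneg (by positivity) (hW i)
      _ ≤ √(c * b) := by
          refine Real.sqrt_le_sqrt ?_
          simp_rw [mul_left_comm _ c, ← Finset.mul_sum]
          gcongr
  simp only [kernelErrorBound]
  generalize A / σl ^ (r + 2) * (hx * σu + hs * (Real.log n + 1)) = bias
  simp only [Finset.sum_add_distrib, ← Finset.mul_sum, Finset.sum_const, Finset.card_univ,
    Fintype.card_fin, nsmul_eq_mul]
  rw [mul_add, mul_add, inv_mul_cancel_left₀ hnn, mul_left_comm (n : ℝ)⁻¹]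
  refine add_le_add (add_le_add hjensen ?_) le_rfl
  gcongr

lemma ae_pi_forall {ι : Type*} [Fintype ι] {α : ι → Type*} [∀ i, MeasurableSpace (α i)]
    {μ : ∀ i, Measure (α i)} [∀ i, SigmaFinite (μ i)] {p : ∀ i, α i → Prop}
    (hp : ∀ i, ∀ᵐ x ∂μ i, p i x) : ∀ᵐ x ∂Measure.pi μ, ∀ i, p i (x i) :=
  eventually_all.2 fun i => Measure.tendsto_eval_ae_ae.eventually (hp i)

/-- The average of the kernel errors over the observations, as a function of the full data. -/
def averageKernelError {n : ℕ} (k : ℝ → ℝ → ℝ) (G : Measure ℝ) (hx hs : ℝ)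
    (D : Fin n → ℝ × ℝ × ℝ) : ℝ :=
  (n : ℝ)⁻¹ * ∑ i, kernelError k G hx hs (fun j => (D j).1) (fun j => (D j).2.2) i

section SampleLaw

variable {r n : ℕ} {A σl σu hx hs : ℝ} {k : ℝ → ℝ → ℝ} {G Gσ : Measure ℝ}
  [IsProbabilityMeasure G] [IsProbabilityMeasure Gσ]

lemma ae_sampleLaw {p : ℝ × ℝ × ℝ → Prop} (hσ : ∀ᵐ σ ∂Gσ, 0 < σ)
    (hp : ∀ᵐ t ∂tripleLaw G Gσ, p t) : ∀ᵐ D ∂sampleLaw n G Gσ, ∀ i, p (D i) := by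
  have := isProbabilityMeasure_tripleLaw (G := G) hσ
  exact ae_pi_forall fun _ => hp

namespace IsGaussianKernel

lemma integrable_kernelError (hk : IsGaussianKernel r A k) (hσl : 0 < σl)
    (hσ : ∀ᵐ σ ∂Gσ, σl ≤ σ) (hx0 : 0 < hx) (hs0 : 0 < hs) (i : Fin n) :
    Integrable (fun D => kernelError k G hx hs (fun j => (D j).1) (fun j => (D j).2.2) i)
      (sampleLaw n G Gσ) := by
  have hpos : ∀ᵐ σ ∂Gσ, 0 < σ := hσ.mono fun _ h => hσl.trans_le h
  have := isProbabilityMeasure_sampleLaw (G := G) n hpos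
  refine .of_bound (measurable_kernelError hk.measurable hx hs i (by fun_prop)
    (by fun_prop)).aestronglyMeasurable (A / (hx * σl) ^ (r + 1) + A / σl ^ (r + 1)) ?_
  filter_upwards [ae_sampleLaw hpos (ae_tripleLaw (ae_of_all G fun _ => trivial) hσ)] with D hD
  exact (abs_abs _).trans_le (hk.kernelError_le hσl (fun j => (hD j).2) hx0 hs0 _ i)

lemma integrable_averageKernelError (hk : IsGaussianKernel r A k) (hσl : 0 < σl)
    (hσ : ∀ᵐ σ ∂Gσ, σl ≤ σ) (hx0 : 0 < hx) (hs0 : 0 < hs) :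
    Integrable (averageKernelError k G hx hs) (sampleLaw n G Gσ) :=
  (integrable_finsetSum _ fun i _ => hk.integrable_kernelError hσl hσ hx0 hs0 i).const_mul _

lemma integral_averageKernelError_le (hk : IsGaussianKernel r A k) (hn : 0 < n) (hσl : 0 < σl)
    (hσ : ∀ᵐ σ ∂Gσ, σl ≤ σ ∧ σ ≤ σu) (hx0 : 0 < hx) (hs0 : 0 < hs) :
    ∫ D, averageKernelError k G hx hs D ∂sampleLaw n G Gσ
      ≤ kernelErrorBound r A σl σu hx hs n (2 * ((σu - σl) / hs + 1) / n) := by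
  refine integral_sampleLaw_le
    (F := fun x s => (n : ℝ)⁻¹ * ∑ i, kernelError k G hx hs x s i)
    (hσ.mono fun _ h => hσl.trans_le h.1) ?_
    (hk.integrable_averageKernelError hσl (hσ.mono fun _ h => h.1) hx0 hs0) ?_
  · exact (Finset.measurable_sum _ fun i _ => measurable_kernelError hk.measurable hx hs i
      measurable_fst measurable_snd).const_mul _
  filter_upwards [ae_pi_forall fun _ : Fin n => hσ] with s hs_mem
  have hσlu := (hs_mem ⟨0, hn⟩).1.trans (hs_mem ⟨0, hn⟩).2
  have hint (i : Fin n) : Integrable (fun x => kernelError k G hx hs x s i)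
      (Measure.pi fun j => obsLaw G (s j)) :=
    .of_bound (measurable_kernelError hk.measurable hx hs i measurable_id
      measurable_const).aestronglyMeasurable _ (ae_of_all _ fun x => (abs_abs _).trans_le
        (hk.kernelError_le hσl (fun j => (hs_mem j).1) hx0 hs0 x i))
  rw [integral_const_mul, integral_finsetSum _ fun i _ => hint i]
  calc _ ≤ (n : ℝ)⁻¹ * ∑ i, kernelErrorBound r A σl σu hx hs n (weight hs s (s i) i) := by
        gcongr with i
        exact hk.integral_kernelError_le hσl hs_mem hx0 hs0 i
    _ ≤ _ := by
        refine kernelErrorBound_average_le hn r hk.const_nonneg hσl hx0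
          (fun i => weight_nonneg hs0 s _ i) ?_
        rw [inv_mul_eq_div]
        gcongr
        exact sum_weight_self_le s hs0 hσlu hs_mem

end IsGaussianKernel

end SampleLaw

/-! ### Truncation and comparison with the oracle -/

lemma abs_clip_le (T r : ℝ) : |max (-T) (min T r)| ≤ |T| := by
  rcases le_total 0 T with h | h
  · rw [abs_of_nonneg h, abs_le]
    exact ⟨le_max_left _ _, max_le (by linarith) (min_le_left _ _)⟩
  · rw [max_eq_left ((min_le_left _ _).trans (by linarith)), abs_neg]

lemma abs_clip_sub_le {T o : ℝ} (ho : |o| ≤ T) (r : ℝ) : |max (-T) (min T r) - o| ≤ |r - o| := by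
  have hclip : max (-T) (min T o) = o := by
    rw [min_eq_right (abs_le.1 ho).2, max_eq_right (abs_le.1 ho).1]
  calc |max (-T) (min T r) - o| = |max (-T) (min T r) - max (-T) (min T o)| := by rw [hclip]
    _ ≤ |min T r - min T o| := by
      simpa using abs_max_sub_max_le_max (-T) (min T r) (-T) (min T o)
    _ ≤ |r - o| := by simpa using abs_min_sub_min_le_max T r T o

lemma abs_clip_sub_le_two_mul {T o : ℝ} (ho : |o| ≤ T) (r : ℝ) :
    |max (-T) (min T r) - o| ≤ 2 * T := by
  have hclip := abs_clip_le T r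
  rw [abs_of_nonneg ((abs_nonneg o).trans ho)] at hclip
  linarith [abs_sub (max (-T) (min T r)) o]

lemma abs_div_sub_div_le {a a' b b' c τ : ℝ} (hτ : 0 < τ) (hτ1 : τ ≤ 1) (ha : τ ≤ a)
    (hab : |b - a| ≤ a / 2) (hc : |a'| ≤ c) :
    |b' / b - a' / a| ≤ 2 * (1 + c) / τ ^ 2 * (|b - a| + |b' - a'|) := by
  have ha0 : 0 < a := hτ.trans_le ha
  have hb : a / 2 ≤ b := by linarith [(abs_le.1 hab).1]
  have hb0 : 0 < b := (half_pos ha0).trans_le hb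
  have hc0 : 0 ≤ c := (abs_nonneg _).trans hc
  have hsplit : b' / b - a' / a = (b' - a') / b - a' * (b - a) / (b * a) := by field_simp; ring
  have hnum : |(b' - a') / b| ≤ 2 * |b' - a'| / τ ^ 2 := by
    rw [abs_div, abs_of_pos hb0]
    calc _ ≤ |b' - a'| / (a / 2) := by gcongr
      _ = 2 * |b' - a'| / a := by field_simp
      _ ≤ _ := by gcongr; nlinarith
  have hden : |a' * (b - a) / (b * a)| ≤ 2 * (c * |b - a|) / τ ^ 2 := by
    rw [abs_div, abs_mul, abs_of_pos (mul_pos hb0 ha0)]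
    calc _ ≤ c * |b - a| / (a / 2 * a) := by gcongr
      _ = 2 * (c * |b - a|) / a ^ 2 := by field_simp
      _ ≤ _ := by gcongr
  calc |b' / b - a' / a| ≤ 2 * |b' - a'| / τ ^ 2 + 2 * (c * |b - a|) / τ ^ 2 := by
        rw [hsplit]; exact (abs_sub _ _).trans (add_le_add hnum hden)
    _ = 2 * (|b' - a'| + c * |b - a|) / τ ^ 2 := by ring
    _ ≤ 2 * ((1 + c) * (|b - a| + |b' - a'|)) / τ ^ 2 := by
        gcongr
        linarith [abs_nonneg (b - a), mul_nonneg hc0 (abs_nonneg (b' - a'))]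
    _ = _ := by ring

lemma abs_clip_tweedie_sub_le {T x v a a' b b' V c τ : ℝ} (hτ : 0 < τ) (hτ1 : τ ≤ 1) (ha : τ ≤ a)
    (ho : |x + v * (a' / a)| ≤ T) (hv0 : 0 ≤ v) (hv : v ≤ V) (hc : |a'| ≤ c) :
    |max (-T) (min T (x + v * (b' / b))) - (x + v * (a' / a))|
      ≤ (4 * T + 2 * V * (1 + c)) / τ ^ 2 * (|b - a| + |b' - a'|) := by
  have hT : 0 ≤ T := (abs_nonneg _).trans ho
  have hV : 0 ≤ V := hv0.trans hv
  have hc0 : 0 ≤ c := (abs_nonneg _).trans hc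
  rcases le_or_gt |b - a| (a / 2) with hab | hab
  · calc _ ≤ |v * (b' / b - a' / a)| := by
          refine (abs_clip_sub_le ho _).trans_eq (congrArg _ (by ring))
      _ ≤ V * (2 * (1 + c) / τ ^ 2 * (|b - a| + |b' - a'|)) := by
          rw [abs_mul, abs_of_nonneg hv0]
          exact mul_le_mul hv (abs_div_sub_div_le hτ hτ1 ha hab hc) (abs_nonneg _) hV
      _ = (0 + 2 * V * (1 + c)) / τ ^ 2 * (|b - a| + |b' - a'|) := by ring
      _ ≤ _ := by gcongr; positivity
  · have hfar : 1 ≤ 2 * |b - a| / τ ^ 2 := by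
      rw [le_div_iff₀ (by positivity)]; nlinarith
    calc _ ≤ 2 * T * 1 := (abs_clip_sub_le_two_mul ho _).trans_eq (mul_one _).symm
      _ ≤ 2 * T * (2 * |b - a| / τ ^ 2) := by gcongr
      _ = (4 * T + 0) / τ ^ 2 * (|b - a| + 0) := by ring
      _ ≤ _ := by gcongr <;> positivity

lemma abs_sq_sub_sub_sq_sub_le {T d o m : ℝ} (hd : |d| ≤ T) (ho : |o| ≤ T) (hm : |m| ≤ T) :
    |(d - m) ^ 2 - (o - m) ^ 2| ≤ 4 * T * |d - o| := by
  have hfactor : (d - m) ^ 2 - (o - m) ^ 2 = (d + o - 2 * m) * (d - o) := by ring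
  rw [hfactor, abs_mul]
  gcongr
  rw [abs_le] at hd ho hm ⊢
  constructor <;> linarith

/-- The triples `(x, μ, σ)` at which the marginal density is below `τ`. The ratio in Tweedie's
formula is estimated well only off this set. -/
def lowDensitySet (G : Measure ℝ) (τ : ℝ) : Set (ℝ × ℝ × ℝ) := {p | marginal G p.2.2 p.1 < τ}

lemma measurableSet_lowDensitySet (G : Measure ℝ) [SFinite G] (τ : ℝ) :
    MeasurableSet (lowDensitySet G τ) :=
  measurableSet_lt ((measurable_mixture measurable_phi).comp
    (by fun_prop : Measurable fun p : ℝ × ℝ × ℝ => (p.2.2, p.1))) measurable_const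

lemma kernelError_nonneg {n : ℕ} (k : ℝ → ℝ → ℝ) (G : Measure ℝ) (hx hs : ℝ) (x s : Fin n → ℝ)
    (i : Fin n) : 0 ≤ kernelError k G hx hs x s i := abs_nonneg _

section Nest

variable {n : ℕ} {G Gσ : Measure ℝ} [IsProbabilityMeasure G] {C T σl σu hx hs R : ℝ}

lemma abs_nest_le (T hx hs : ℝ) (x s : Fin n → ℝ) (i : Fin n) : |nest T hx hs x s i| ≤ |T| :=
  abs_clip_le T _

lemma measurable_nest (T hx hs : ℝ) (i : Fin n) :
    Measurable fun D : Fin n → ℝ × ℝ × ℝ =>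
      nest T hx hs (fun j => (D j).1) (fun j => (D j).2.2) i := by
  have hest {k : ℝ → ℝ → ℝ} (hk : Measurable fun p : ℝ × ℝ => k p.1 p.2) :
      Measurable fun D : Fin n → ℝ × ℝ × ℝ =>
        kernelEst k hx hs (fun j => (D j).1) (fun j => (D j).2.2) (D i).2.2 (D i).1 :=
    measurable_kernelEst hk hx hs (by fun_prop) (by fun_prop) (by fun_prop) (by fun_prop)
  unfold nest nestRaw
  simp_rw [deriv_kde]
  exact measurable_const.max (measurable_const.min (Measurable.add (by fun_prop)
    (Measurable.mul (by fun_prop) ((hest measurable_dphi).div (hest measurable_phi)))))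

lemma abs_nest_sub_oracle_le_of_le_marginal (hT : ∀ᵐ m ∂G, |m| ≤ T) (hσl : 0 < σl)
    (hR : 1 ≤ R) {x s : Fin n → ℝ} {i : Fin n} (hs_mem : σl ≤ s i ∧ s i ≤ σu)
    (hlow : 1 / R ^ 2 ≤ marginal G (s i) (x i)) :
    |nest T hx hs x s i - oracle G (x i) (s i)|
      ≤ (4 * T + 2 * σu ^ 2 * (1 + 5 / σl ^ 2)) * R ^ 4
        * (kernelError phi G hx hs x s i + kernelError dphi G hx hs x s i) := by
  have hsi := hσl.trans_le hs_mem.1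
  have hdphi : |deriv (marginal G (s i)) (x i)| ≤ 5 / σl ^ 2 := by
    rw [deriv_marginal]
    refine (isGaussianKernel_dphi.abs_mixture_le hsi _).trans ?_
    gcongr
    exact hs_mem.1
  refine (abs_clip_tweedie_sub_le (by positivity) ((div_le_one (by positivity)).2
    (one_le_pow₀ hR)) hlow (abs_oracle_le hsi hT (x i)) (sq_nonneg _)
    (pow_le_pow_left₀ hsi.le hs_mem.2 2) hdphi).trans_eq ?_
  rw [deriv_kde, deriv_marginal, div_pow, one_pow, div_div_eq_mul_div, div_one, ← pow_mul]
  rfl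

lemma abs_nest_loss_sub_oracleLoss_le (hT : ∀ᵐ m ∂G, |m| ≤ T) (hσl : 0 < σl) (hR : 1 ≤ R)
    {D : Fin n → ℝ × ℝ × ℝ} {i : Fin n} (hm : |(D i).2.1| ≤ T)
    (hs_mem : σl ≤ (D i).2.2 ∧ (D i).2.2 ≤ σu) :
    |(nest T hx hs (fun j => (D j).1) (fun j => (D j).2.2) i - (D i).2.1) ^ 2 - oracleLoss G (D i)|
      ≤ 4 * T * (2 * T * (lowDensitySet G (1 / R ^ 2)).indicator 1 (D i)
        + (4 * T + 2 * σu ^ 2 * (1 + 5 / σl ^ 2)) * R ^ 4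
          * (kernelError phi G hx hs (fun j => (D j).1) (fun j => (D j).2.2) i
            + kernelError dphi G hx hs (fun j => (D j).1) (fun j => (D j).2.2) i)) := by
  have hT0 : 0 ≤ T := (abs_nonneg _).trans hm
  have horacle := abs_oracle_le (hσl.trans_le hs_mem.1) hT (D i).1
  refine (abs_sq_sub_sub_sq_sub_le ((abs_nest_le _ _ _ _ _ _).trans_eq (abs_of_nonneg hT0))
    horacle hm).trans ?_
  gcongr
  by_cases hlow : D i ∈ lowDensitySet G (1 / R ^ 2)
  · rw [Set.indicator_of_mem hlow, Pi.one_apply, mul_one]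
    refine (abs_clip_sub_le_two_mul horacle _).trans (le_add_of_nonneg_right ?_)
    exact mul_nonneg (by positivity) (add_nonneg (kernelError_nonneg ..) (kernelError_nonneg ..))
  · rw [Set.indicator_of_notMem hlow, mul_zero, zero_add]
    exact abs_nest_sub_oracle_le_of_le_marginal hT hσl hR hs_mem (not_lt.1 hlow)

lemma abs_compoundLoss_sub_average_oracleLoss_le (hT : ∀ᵐ m ∂G, |m| ≤ T) (hσl : 0 < σl)
    (hR : 1 ≤ R) {D : Fin n → ℝ × ℝ × ℝ}
    (hD : ∀ i, |(D i).2.1| ≤ T ∧ σl ≤ (D i).2.2 ∧ (D i).2.2 ≤ σu) :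
    |compoundLoss (nest T hx hs) D - (n : ℝ)⁻¹ * ∑ i, oracleLoss G (D i)|
      ≤ 4 * T * (2 * T * ((n : ℝ)⁻¹ * ∑ i, (lowDensitySet G (1 / R ^ 2)).indicator 1 (D i))
        + (4 * T + 2 * σu ^ 2 * (1 + 5 / σl ^ 2)) * R ^ 4
          * (averageKernelError phi G hx hs D + averageKernelError dphi G hx hs D)) := by
  rw [compoundLoss, ← mul_sub, ← Finset.sum_sub_distrib, abs_mul, abs_of_nonneg (by positivity)]
  calc _ ≤ (n : ℝ)⁻¹ * ∑ i, _ := by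
        gcongr
        exact (Finset.abs_sum_le_sum_abs _ _).trans (Finset.sum_le_sum fun i _ =>
          abs_nest_loss_sub_oracleLoss_le hT hσl hR (hD i).1 (hD i).2)
    _ = _ := by
        simp only [averageKernelError, ← Finset.mul_sum, Finset.sum_add_distrib]
        ring

variable [IsProbabilityMeasure Gσ]

lemma integrable_nest_loss (hC : ∀ᵐ m ∂G, |m| ≤ C) (hσ : ∀ᵐ σ ∂Gσ, 0 < σ) (T hx hs : ℝ)
    (i : Fin n) :
    Integrable (fun D => (nest T hx hs (fun j => (D j).1) (fun j => (D j).2.2) i - (D i).2.1) ^ 2)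
      (sampleLaw n G Gσ) := by
  have := isProbabilityMeasure_sampleLaw (G := G) n hσ
  refine .of_bound (((measurable_nest T hx hs i).sub (by fun_prop)).pow_const
    2).aestronglyMeasurable ((|T| + C) ^ 2) ?_
  filter_upwards [ae_sampleLaw hσ (ae_tripleLaw hC hσ)] with D hD
  rw [Real.norm_eq_abs, abs_pow]
  gcongr
  exact (abs_sub _ _).trans (add_le_add (abs_nest_le _ _ _ _ _ _) (hD i).1)

lemma integrable_oracleLoss (hC : ∀ᵐ m ∂G, |m| ≤ C) (hσ : ∀ᵐ σ ∂Gσ, 0 < σ) :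
    Integrable (oracleLoss G) (tripleLaw G Gσ) := by
  have := isProbabilityMeasure_tripleLaw (G := G) hσ
  refine .of_bound (((measurable_oracle.comp (by fun_prop : Measurable fun p : ℝ × ℝ × ℝ =>
    (p.1, p.2.2))).sub (by fun_prop)).pow_const 2).aestronglyMeasurable ((C + C) ^ 2) ?_
  filter_upwards [ae_tripleLaw hC hσ] with p hp
  rw [oracleLoss, Real.norm_eq_abs, abs_pow]
  gcongr
  exact (abs_sub _ _).trans (add_le_add (abs_oracle_le hp.2 hC _) hp.1)

lemma integrable_compoundLoss_nest (hC : ∀ᵐ m ∂G, |m| ≤ C) (hσ : ∀ᵐ σ ∂Gσ, 0 < σ)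
    (T hx hs : ℝ) :
    Integrable (compoundLoss (nest (n := n) T hx hs)) (sampleLaw n G Gσ) :=
  (integrable_finsetSum _ fun i _ => integrable_nest_loss hC hσ T hx hs i).const_mul _

lemma integrable_average_sampleLaw (hσ : ∀ᵐ σ ∂Gσ, 0 < σ) {f : ℝ × ℝ × ℝ → ℝ}
    (hf : Integrable f (tripleLaw G Gσ)) :
    Integrable (fun D : Fin n → ℝ × ℝ × ℝ => (n : ℝ)⁻¹ * ∑ i, f (D i)) (sampleLaw n G Gσ) := by
  have := isProbabilityMeasure_tripleLaw (G := G) hσ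
  exact (integrable_finsetSum _ fun i _ =>
    (measurePreserving_eval _ i).integrable_comp_of_integrable hf).const_mul _

lemma integral_average_sampleLaw (hn : 0 < n) (hσ : ∀ᵐ σ ∂Gσ, 0 < σ) {f : ℝ × ℝ × ℝ → ℝ}
    (hf : Integrable f (tripleLaw G Gσ)) :
    ∫ D : Fin n → ℝ × ℝ × ℝ, (n : ℝ)⁻¹ * ∑ i, f (D i) ∂sampleLaw n G Gσ
      = ∫ p, f p ∂tripleLaw G Gσ := by
  have := isProbabilityMeasure_tripleLaw (G := G) hσ
  unfold sampleLaw
  have hint (i : Fin n) : Integrable (fun D : Fin n → ℝ × ℝ × ℝ => f (D i))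
      (Measure.pi fun _ => tripleLaw G Gσ) :=
    (measurePreserving_eval _ i).integrable_comp_of_integrable hf
  rw [integral_const_mul, integral_finsetSum _ fun i _ => hint i]
  simp_rw [integral_comp_eval (μ := fun _ : Fin n => tripleLaw G Gσ) hf.aestronglyMeasurable]
  rw [Finset.sum_const, Finset.card_univ, Fintype.card_fin, nsmul_eq_mul,
    inv_mul_cancel_left₀ (by positivity)]

lemma tripleLaw_lowDensitySet_le (hC : ∀ᵐ m ∂G, |m| ≤ C) (hσl : 0 < σl)
    (hσ : ∀ᵐ σ ∂Gσ, σl ≤ σ ∧ σ ≤ σu) (hR : 0 < R) :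
    (tripleLaw G Gσ).real (lowDensitySet G (1 / R ^ 2))
      ≤ 2 / R + (2 * C ^ 2 + 2 * σu ^ 2) / R ^ 2 := by
  have hS : MeasurableSet {p : ℝ × ℝ | marginal G p.2 p.1 < 1 / R ^ 2} :=
    measurableSet_lt ((measurable_mixture measurable_phi).comp measurable_swap) measurable_const
  refine ENNReal.toReal_le_of_le_ofReal (by positivity)
    (tripleLaw_apply_le (hσ.mono fun _ h => hσl.trans_le h.1) hS ?_)
  filter_upwards [hσ] with σ hσ
  have hσ0 := hσl.trans_le hσ.1
  refine (obsLaw_marginal_lt_le hC hσ0 hR (by positivity)).trans (ENNReal.ofReal_le_ofReal ?_)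
  have hlow : 1 / R ^ 2 * (2 * R) = 2 / R := by field_simp
  rw [hlow]
  gcongr
  exact hσ.2

/-- Bound for the excess risk of the estimator truncated at `T` when observations of marginal
density below `1 / R ^ 2` are set apart and `E` bounds the mean kernel errors. -/
def riskBound (T σl σu R E : ℝ) : ℝ :=
  4 * T * (2 * T * (2 / R + (2 * T ^ 2 + 2 * σu ^ 2) / R ^ 2)
    + (4 * T + 2 * σu ^ 2 * (1 + 5 / σl ^ 2)) * R ^ 4 * E)

lemma abs_compoundRisk_sub_oracleRisk_le (hT : ∀ᵐ m ∂G, |m| ≤ T) (hσl : 0 < σl)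
    (hσ : ∀ᵐ σ ∂Gσ, σl ≤ σ ∧ σ ≤ σu) (hn : 0 < n) (hx0 : 0 < hx) (hs0 : 0 < hs) (hR : 1 ≤ R) :
    |compoundRisk (nest (n := n) T hx hs) G Gσ - oracleRisk G Gσ|
      ≤ riskBound T σl σu R
        (kernelErrorBound 0 1 σl σu hx hs n (2 * ((σu - σl) / hs + 1) / n)
          + kernelErrorBound 1 5 σl σu hx hs n (2 * ((σu - σl) / hs + 1) / n)) := by
  have hT0 : 0 ≤ T := hT.exists.elim fun _ h => (abs_nonneg _).trans h
  have hpos : ∀ᵐ σ ∂Gσ, 0 < σ := hσ.mono fun _ h => hσl.trans_le h.1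
  have hlower : ∀ᵐ σ ∂Gσ, σl ≤ σ := hσ.mono fun _ h => h.1
  have := isProbabilityMeasure_tripleLaw (G := G) hpos
  have hlow : Integrable ((lowDensitySet G (1 / R ^ 2)).indicator (1 : ℝ × ℝ × ℝ → ℝ))
      (tripleLaw G Gσ) :=
    (integrable_indicator_iff (measurableSet_lowDensitySet G _)).2 (integrable_const 1).integrableOn
  have horacle := integrable_oracleLoss hT hpos
  have hphi : Integrable (averageKernelError phi G hx hs) (sampleLaw n G Gσ) :=
    isGaussianKernel_phi.integrable_averageKernelError hσl hlower hx0 hs0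
  have hdphi : Integrable (averageKernelError dphi G hx hs) (sampleLaw n G Gσ) :=
    isGaussianKernel_dphi.integrable_averageKernelError hσl hlower hx0 hs0
  have hsum : Integrable (fun D => averageKernelError phi G hx hs D
      + averageKernelError dphi G hx hs D) (sampleLaw n G Gσ) := hphi.add hdphi
  have hlowAverage := integrable_average_sampleLaw (n := n) hpos hlow
  rw [compoundRisk, oracleRisk, ← integral_average_sampleLaw hn hpos horacle,
    ← integral_sub (integrable_compoundLoss_nest hT hpos T hx hs)
      (integrable_average_sampleLaw hpos horacle)]
  calc _ ≤ ∫ D, 4 * T * (2 * T * ((n : ℝ)⁻¹ * ∑ i, (lowDensitySet G (1 / R ^ 2)).indicator 1 (D i))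
        + (4 * T + 2 * σu ^ 2 * (1 + 5 / σl ^ 2)) * R ^ 4
          * (averageKernelError phi G hx hs D + averageKernelError dphi G hx hs D))
        ∂sampleLaw n G Gσ := by
        rw [← Real.norm_eq_abs]
        refine norm_integral_le_of_norm_le
          (((hlowAverage.const_mul _).add (hsum.const_mul _)).const_mul _) ?_
        filter_upwards [ae_sampleLaw hpos (ae_tripleLaw hT hσ)] with D hD
        exact abs_compoundLoss_sub_average_oracleLoss_le hT hσl hR hD
    _ = 4 * T * (2 * T * (tripleLaw G Gσ).real (lowDensitySet G (1 / R ^ 2))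
        + (4 * T + 2 * σu ^ 2 * (1 + 5 / σl ^ 2)) * R ^ 4
          * (∫ D, averageKernelError phi G hx hs D ∂sampleLaw n G Gσ
            + ∫ D, averageKernelError dphi G hx hs D ∂sampleLaw n G Gσ)) := by
        rw [integral_const_mul, integral_add (hlowAverage.const_mul _) (hsum.const_mul _),
          integral_const_mul (2 * T), integral_const_mul (_ * R ^ 4), integral_add hphi hdphi,
          integral_average_sampleLaw hn hpos hlow,
          integral_indicator_one (measurableSet_lowDensitySet G _)]
    _ ≤ _ := by
        unfold riskBound
        gcongr
        · exact tripleLaw_lowDensitySet_le hT hσl hσ (by positivity)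
        · exact isGaussianKernel_phi.integral_averageKernelError_le hn hσl hσ hx0 hs0
        · exact isGaussianKernel_dphi.integral_averageKernelError_le hn hσl hσ hx0 hs0

end Nest

section Asymptotics

variable {f : ℕ → ℝ} {a b : ℝ}

lemma isBigO_rpow_mono (hf : f =O[atTop] fun n : ℕ => (n : ℝ) ^ a) (hab : a ≤ b) :
    f =O[atTop] fun n : ℕ => (n : ℝ) ^ b := by
  refine hf.trans (IsBigO.of_bound 1 ?_)
  filter_upwards [eventually_ge_atTop 1] with n hn
  have hn' : (1 : ℝ) ≤ n := by exact_mod_cast hn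
  rw [one_mul, Real.norm_of_nonneg (by positivity), Real.norm_of_nonneg (by positivity)]
  exact Real.rpow_le_rpow_of_exponent_le hn' hab

lemma isBigO_rpow_pow (hf : f =O[atTop] fun n : ℕ => (n : ℝ) ^ a) (k : ℕ) :
    (fun n => f n ^ k) =O[atTop] fun n : ℕ => (n : ℝ) ^ (a * k) :=
  (hf.pow k).congr_right fun n => (Real.rpow_mul_natCast n.cast_nonneg a k).symm

lemma isBigO_const_rpow (c : ℝ) (ha : 0 ≤ a) :
    (fun _ : ℕ => c) =O[atTop] fun n : ℕ => (n : ℝ) ^ a :=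
  isBigO_rpow_mono (a := 0) (by simpa using isBigO_const_const c (one_ne_zero (α := ℝ)) _) ha

lemma isBigO_inv_rpow (hf : f =Θ[atTop] fun n : ℕ => (n : ℝ) ^ a) :
    (fun n => (f n)⁻¹) =O[atTop] fun n : ℕ => (n : ℝ) ^ (-a) :=
  hf.inv.1.congr_right fun n => (Real.rpow_neg n.cast_nonneg a).symm

lemma isBigO_log_rpow (ha : 0 < a) :
    (fun n : ℕ => Real.log n) =O[atTop] fun n : ℕ => (n : ℝ) ^ a :=
  (isLittleO_log_rpow_atTop ha).isBigO.comp_tendsto tendsto_natCast_atTop_atTop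

lemma isBigO_rpow_sqrt (hf : f =O[atTop] fun n : ℕ => (n : ℝ) ^ a) :
    (fun n => √(f n)) =O[atTop] fun n : ℕ => (n : ℝ) ^ (a / 2) :=
  (hf.sqrt (Eventually.of_forall fun n => by positivity)).congr_right fun n => by
    rw [Real.sqrt_eq_rpow, ← Real.rpow_mul n.cast_nonneg, mul_one_div]

lemma tendsto_zero_of_isBigO_rpow (hf : f =O[atTop] fun n : ℕ => (n : ℝ) ^ a) (ha : a < 0) :
    Tendsto f atTop (𝓝 0) := by
  refine hf.trans_tendsto ?_
  simpa [Function.comp_def] using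
    (tendsto_rpow_neg_atTop (neg_pos.2 ha)).comp (tendsto_natCast_atTop_atTop (R := ℝ))

lemma isBigO_div_pow_mul_averageWeight (σl σu c : ℝ) (k : ℕ) {ηx ηs : ℝ} (hηs : 0 < ηs)
    {hx hs : ℕ → ℝ} (hx_rate : hx =Θ[atTop] fun n : ℕ => (n : ℝ) ^ (-ηx))
    (hs_rate : hs =Θ[atTop] fun n : ℕ => (n : ℝ) ^ (-ηs)) :
    (fun n => c / (hx n * σl) ^ k * (2 * ((σu - σl) / hs n + 1) / n))
      =O[atTop] fun n : ℕ => (n : ℝ) ^ (ηx * k + ηs - 1) := by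
  have hxinv := isBigO_inv_rpow hx_rate
  have hsinv := isBigO_inv_rpow hs_rate
  have hninv := isBigO_inv_rpow (f := fun n : ℕ => (n : ℝ)) (a := 1) (by simp [isTheta_refl])
  rw [neg_neg] at hxinv hsinv
  have hweight : (fun n => 2 * ((σu - σl) / hs n + 1) / n)
      =O[atTop] fun n : ℕ => (n : ℝ) ^ (ηs - 1) :=
    .mul_atTop_rpow_natCast_of_isBigO_rpow _ _ _ (((hsinv.const_mul_left (σu - σl)).add
      (isBigO_const_rpow 1 hηs.le)).const_mul_left 2) hninv le_rfl
  have hpow : (fun n => c / (hx n * σl) ^ k) =O[atTop] fun n : ℕ => (n : ℝ) ^ (ηx * k) :=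
    ((isBigO_rpow_pow hxinv k).const_mul_left (c * (σl ^ k)⁻¹)).congr_left fun n => by
      simp only [mul_pow, div_eq_mul_inv, mul_inv, inv_pow]
      ring
  exact .mul_atTop_rpow_natCast_of_isBigO_rpow _ _ _ hpow hweight (by linarith)

lemma isBigO_kernelErrorBound (r : ℕ) (A σl σu : ℝ) {ηx ηs : ℝ} (hηx : 0 < ηx) (hηs : 0 < ηs)
    (hη : (2 * r + 1) * ηx + ηs < 1) {hx hs : ℕ → ℝ}
    (hx_rate : hx =Θ[atTop] fun n : ℕ => (n : ℝ) ^ (-ηx))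
    (hs_rate : hs =Θ[atTop] fun n : ℕ => (n : ℝ) ^ (-ηs)) :
    ∃ ρ : ℝ, 0 < ρ ∧ (fun n : ℕ => kernelErrorBound r A σl σu (hx n) (hs n) n
      (2 * ((σu - σl) / hs n + 1) / n)) =O[atTop] fun n : ℕ => (n : ℝ) ^ (-ρ) := by
  set κ := (1 - (2 * r + 1) * ηx - ηs) / 2 with hκ
  have hκ0 : 0 < κ := by rw [hκ]; linarith
  refine ⟨min κ (min ηx (ηs / 2)), by positivity, ?_⟩
  set ρ := min κ (min ηx (ηs / 2))
  have hρκ : ρ ≤ κ := min_le_left _ _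
  have hρx : ρ ≤ ηx := (min_le_right _ _).trans (min_le_left _ _)
  have hρs : ρ ≤ ηs / 2 := (min_le_right _ _).trans (min_le_right _ _)
  have hrηx : 0 ≤ r * ηx := by positivity
  have hsd := isBigO_rpow_mono (b := -ρ) (isBigO_rpow_sqrt
    (isBigO_div_pow_mul_averageWeight σl σu (A / σl) (2 * r + 1) hηs hx_rate hs_rate))
    (by push_cast; linarith)
  have hown := isBigO_rpow_mono (b := -ρ)
    (isBigO_div_pow_mul_averageWeight σl σu (2 * A) (r + 1) hηs hx_rate hs_rate)
    (by push_cast; linarith)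
  have hbias_x := isBigO_rpow_mono (b := -ρ) (hx_rate.1.const_mul_left σu) (by linarith)
  have hbias_s := IsBigO.mul_atTop_rpow_natCast_of_isBigO_rpow _ _ (-ρ) hs_rate.1
    ((isBigO_log_rpow (half_pos hηs)).add (isBigO_const_rpow 1 (half_pos hηs).le)) (by linarith)
  refine ((hsd.add hown).add ((hbias_x.add hbias_s).const_mul_left
    (A / σl ^ (r + 2)))).congr_left fun n => ?_
  simp only [kernelErrorBound, Pi.mul_apply, div_div, mul_comm σl, mul_comm σu]

lemma tendsto_riskBound {T E : ℕ → ℝ} {ρ : ℝ} (hρ : 0 < ρ)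
    (hT : ∀ ε : ℝ, 0 < ε → T =o[atTop] fun n : ℕ => (n : ℝ) ^ ε)
    (hE : E =O[atTop] fun n : ℕ => (n : ℝ) ^ (-ρ)) (σl σu : ℝ) :
    Tendsto (fun n : ℕ => riskBound (T n) σl σu ((n : ℝ) ^ (ρ / 8)) (E n)) atTop (𝓝 0) := by
  have hT' := (hT (ρ / 64) (by positivity)).isBigO
  have hR : (fun n : ℕ => (n : ℝ) ^ (ρ / 8)) =Θ[atTop] fun n : ℕ => (n : ℝ) ^ (ρ / 8) :=
    isTheta_refl _ _
  have hRinv := isBigO_inv_rpow hR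
  have hsep := (hRinv.const_mul_left 2).add
    (.mul_atTop_rpow_natCast_of_isBigO_rpow _ _ (-(ρ / 8))
      (((isBigO_rpow_pow hT' 2).const_mul_left 2).add
        (isBigO_const_rpow (2 * σu ^ 2) (by positivity)))
      (isBigO_rpow_pow hRinv 2) (by push_cast; linarith))
  have hfactor := IsBigO.mul_atTop_rpow_natCast_of_isBigO_rpow _ _ (ρ / 64 + ρ / 2)
    ((hT'.const_mul_left 4).add (isBigO_const_rpow (2 * σu ^ 2 * (1 + 5 / σl ^ 2)) (by positivity)))
    (isBigO_rpow_pow hR.1 4) (by push_cast; linarith)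
  have hlow := IsBigO.mul_atTop_rpow_natCast_of_isBigO_rpow _ _ (-(ρ / 16))
    (hT'.const_mul_left 2) hsep (by linarith)
  have hkernel := IsBigO.mul_atTop_rpow_natCast_of_isBigO_rpow _ _ (-(ρ / 16)) hfactor hE
    (by linarith)
  have hbound := IsBigO.mul_atTop_rpow_natCast_of_isBigO_rpow _ _ (-(ρ / 32))
    (hT'.const_mul_left 4) (hlow.add hkernel) (by linarith)
  refine tendsto_zero_of_isBigO_rpow (hbound.congr_left fun n => ?_) (by linarith)
  simp only [riskBound, Pi.mul_apply, div_eq_mul_inv, inv_pow]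

variable {G Gσ : ℕ → Measure ℝ} [∀ n, IsProbabilityMeasure (G n)]
  [∀ n, IsProbabilityMeasure (Gσ n)] {σl σu ηx ηs : ℝ} {T hx hs : ℕ → ℝ}

lemma tendsto_compoundRisk_sub_oracleRisk (hσl : 0 < σl)
    (hσ : ∀ n, ∀ᵐ s ∂(Gσ n), σl ≤ s ∧ s ≤ σu)
    (hT : ∀ᶠ n in atTop, ∀ᵐ m ∂(G n), |m| ≤ T n)
    (hTo : ∀ ε : ℝ, 0 < ε → T =o[atTop] fun n : ℕ => (n : ℝ) ^ ε)
    (hηx : 0 < ηx) (hηs : 0 < ηs) (hη : 3 * ηx + ηs < 1)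
    (hx_pos : ∀ n, 0 < n → 0 < hx n) (hs_pos : ∀ n, 0 < n → 0 < hs n)
    (hx_rate : hx =Θ[atTop] fun n : ℕ => (n : ℝ) ^ (-ηx))
    (hs_rate : hs =Θ[atTop] fun n : ℕ => (n : ℝ) ^ (-ηs)) :
    Tendsto (fun n : ℕ => compoundRisk (nest (n := n) (T n) (hx n) (hs n)) (G n) (Gσ n)
      - oracleRisk (G n) (Gσ n)) atTop (𝓝 0) := by
  obtain ⟨ρ₀, hρ₀, hE₀⟩ := isBigO_kernelErrorBound 0 1 σl σu hηx hηs
    (by push_cast; linarith) hx_rate hs_rate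
  obtain ⟨ρ₁, hρ₁, hE₁⟩ := isBigO_kernelErrorBound 1 5 σl σu hηx hηs
    (by push_cast; linarith) hx_rate hs_rate
  have hρ : 0 < min ρ₀ ρ₁ := lt_min hρ₀ hρ₁
  refine squeeze_zero_norm' ?_ (tendsto_riskBound hρ hTo
    ((isBigO_rpow_mono hE₀ (neg_le_neg (min_le_left ρ₀ ρ₁))).add
      (isBigO_rpow_mono hE₁ (neg_le_neg (min_le_right ρ₀ ρ₁)))) σl σu)
  filter_upwards [hT, eventually_ge_atTop 1] with n hTn hn
  exact abs_compoundRisk_sub_oracleRisk_le hTn hσl (hσ n) hn (hx_pos n hn) (hs_pos n hn)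
    (Real.one_le_rpow (by exact_mod_cast hn) (by positivity))

end Asymptotics

end NEST

end

theorem theorem4p1
    -- the priors, which may change with the number `n` of observations
    (Gμ Gσ : ℕ → Measure ℝ)
    [∀ n, IsProbabilityMeasure (Gμ n)] [∀ n, IsProbabilityMeasure (Gσ n)]
    -- the means are bounded by `C n`, which grows slower than every power of `n`
    (C : ℕ → ℝ) (hC : ∀ n, ∀ᵐ m ∂(Gμ n), |m| ≤ C n)
    (hCo : ∀ ε : ℝ, 0 < ε → C =o[atTop] fun n : ℕ => (n : ℝ) ^ ε)
    -- the standard deviations are bounded above and away from zero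
    (σl σu : ℝ) (hσl : 0 < σl) (hσ : ∀ n, ∀ᵐ s ∂(Gσ n), σl ≤ s ∧ s ≤ σu)
    -- the truncation level
    (T : ℕ → ℝ) (hCT : ∀ᶠ n in atTop, C n ≤ T n)
    (hTo : ∀ ε : ℝ, 0 < ε → T =o[atTop] fun n : ℕ => (n : ℝ) ^ ε)
    -- the bandwidths
    (ηx ηs : ℝ) (hηx : 0 < ηx) (hηs : 0 < ηs) (hη : 3 * ηx + ηs < 1)
    (hx hs : ℕ → ℝ) (hx_pos : ∀ n, 0 < n → 0 < hx n) (hs_pos : ∀ n, 0 < n → 0 < hs n)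
    (hx_rate : hx =Θ[atTop] fun n : ℕ => (n : ℝ) ^ (-ηx))
    (hs_rate : hs =Θ[atTop] fun n : ℕ => (n : ℝ) ^ (-ηs)) :
    (∀ n, Integrable (NEST.compoundLoss (NEST.nest (n := n) (T n) (hx n) (hs n)))
      (NEST.sampleLaw n (Gμ n) (Gσ n))) ∧
    (∀ n, Integrable (NEST.oracleLoss (Gμ n)) (NEST.tripleLaw (Gμ n) (Gσ n))) ∧
    Tendsto (fun n : ℕ =>
        NEST.compoundRisk (NEST.nest (n := n) (T n) (hx n) (hs n)) (Gμ n) (Gσ n)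
          - NEST.oracleRisk (Gμ n) (Gσ n))
      atTop (𝓝 0) := by
  have hσ_pos (n : ℕ) : ∀ᵐ s ∂(Gσ n), 0 < s := (hσ n).mono fun _ hs => hσl.trans_le hs.1
  have hT : ∀ᶠ n in atTop, ∀ᵐ m ∂(Gμ n), |m| ≤ T n :=
    hCT.mono fun n hn => (hC n).mono fun _ hm => hm.trans hn
  exact ⟨fun n => NEST.integrable_compoundLoss_nest (hC n) (hσ_pos n) (T n) (hx n) (hs n),
    fun n => NEST.integrable_oracleLoss (hC n) (hσ_pos n),
    NEST.tendsto_compoundRisk_sub_oracleRisk hσl hσ hT hTo hηx hηs hη hx_pos hs_pos hx_rate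
      hs_rate⟩
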